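/- Let $\Bbbk$ be a field of characteristic $0$ and $\ell$ a natural number, $I=\{1,\dots,\ell\}$; tensor products are over $\Bbbk$. Let $\mathcal R=\mathcal R_\ell=\Bbbk\langle u_{i,n}\mid i\in I,\ n\in\mathbb Z\rangle$ be the free algebra of non-commutative difference polynomials, with the automorphism $S(u_{i,n})=u_{i,n+1}$ (acting diagonally on $\mathcal R\otimes\mathcal R$) and the $2$-fold derivations $\frac{\partial}{\partial u_{i,n}}:\mathcal R\to\mathcal R\otimes\mathcal R$, $\frac{\partial}{\partial u_{i,n}}(u_{i_1,n_1}\cdots u_{i_s,n_s})=\sum_{r:\,(i_r,n_r)=(i,n)}u_{i_1,n_1}\cdots u_{i_{r-1},n_{r-1}}\otimes u_{i_{r+1},n_{r+1}}\cdots u_{i_s,n_s}$. For $a,b\in\mathcal R$ put $(a\otimes b)^\sigma=b\otimes a$ and $\mathrm m(a\otimes b)=ab$, and for $f\in\mathcal R$ put $\frac{\delta f}{\delta u_i}=\sum_{n\in\mathbb Z}S^{-n}\frac{\partial f}{\partial u_{i,n}}\in\mathcal R\otimes\mathcal R$. The de Rham algebra $\widetilde\Omega$ is the free product of $\mathcal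 R$ and $\Bbbk\langle\delta u_{i,n}\mid i\in I,\ n\in\mathbb Z\rangle$, a superalgebra graded by the number of letters $\delta u_{i,n}$, with $S(\delta u_{i,n})=\delta u_{i,n+1}$ and with the odd derivation $\delta$ determined by $\delta(u_{i,n})=\delta u_{i,n}$ and $\delta(\delta u_{i,n})=0$. The variational complex is $\Omega=\widetilde\Omega/\big((S-1)\widetilde\Omega+[\widetilde\Omega,\widetilde\Omega]\big)$, where $[\cdot,\cdot]$ is the supercommutator, with the differential induced by $\delta$; write $[\omega]$ for the class of $\omega\in\widetilde\Omega$. An element of $\Omega$ is called closed if $\delta$ kills it. The element $f\in\mathcal R$ defines the $0$-form $\int f=[f]$. The tuple $F=(F_i)_{i\in I}\in\mathcal R^{\oplus\ell}$ defines the $1$-form $\big[\sum_{i}F_i\,\delta u_{i,0}\big]$. Let $\Sigma^2$ be the space of arrays $A=(A_{ij}(\lambda))_{i,j\in I}$ with entries $A_{ij}(\lambda)=\sum_{n}A_{ij}^n\lambda^n\in(\mathcal R\otimes\mathcal R)[\lambda,\lambda^{-1}]$ such that $A_{ij}(\lambda)=-\sum_{n}\lambda^{-n}S^{-n}\big((A_{ji}^n)^\sigma\big)$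 for all $i,j$. The array $A\in\Sigma^2$ defines the $2$-form $\big[\sum_{i,j\in I,\,n\in\mathbb Z}(A_{ij}^n)'\,\delta u_{i,n}\,(A_{ij}^n)''\,\delta u_{j,0}\big]$ (where $a=a'\otimes a''$ is Sweedler's notation for $a\in\mathcal R\otimes\mathcal R$). Then: (a) For $f\in\mathcal R$, the $0$-form $\int f$ is closed if and only if $f\in\Bbbk+[\mathcal R,\mathcal R]+(S-1)\mathcal R$, where $[\mathcal R,\mathcal R]$ is the span of the commutators $ab-ba$. (b) For $F=(F_i)_{i\in I}\in\mathcal R^{\oplus\ell}$, the $1$-form defined by $F$ is closed if and only if there is $f\in\mathcal R$ (representing a local functional $\int f\in\mathcal R/([\mathcal R,\mathcal R]+(S-1)\mathcal R)$) such that $F_i=\mathrm m\Big(\Big(\frac{\delta f}{\delta u_i}\Big)^{\sigma}\Big)$ for every $i\in I$. (c) For $A=(A_{ij}(\lambda))_{i,j\in I}\in\Sigma^2$, the $2$-form defined by $A$ is closed if and only if there is $F=(F_i)_{i\in I}\in\mathcal R^{\oplus\ell}$ such that, for all $i,j\in I$, $$A_{ij}(\lambda)=\frac12\sum_{n\in\mathbb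 Z}\Big(\frac{\partial F_j}{\partial u_{i,n}}\lambda^n-(\lambda S)^{-n}\Big(\frac{\partial F_i}{\partial u_{j,n}}\Big)^{\sigma}\Big).$$ -/

import Mathlib

open scoped TensorProduct

noncomputable section

namespace NCDiff

/-- The algebra `R_ℓ` of non-commutative difference polynomials: non-commutative polynomials over
`k` in the indeterminates `u_{i,n}`, `i ∈ {1,…,ℓ}`, `n ∈ ℤ`. -/
abbrev DiffPoly (k : Type*) [Field k] (ℓ : ℕ) : Type _ := FreeAlgebra k (Fin ℓ × ℤ)

/-- The underlying algebra of the de Rham complex of `R_ℓ`: the free product of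
`R_ℓ = k⟨u_{i,n}⟩` and `k⟨δu_{i,n}⟩`, that is, the free algebra on the disjoint union of the
letters `u_{i,n}` (left summand) and `δu_{i,n}` (right summand). -/
abbrev DeRham (k : Type*) [Field k] (ℓ : ℕ) : Type _ :=
  FreeAlgebra k ((Fin ℓ × ℤ) ⊕ (Fin ℓ × ℤ))

variable {k : Type*} [Field k] {ℓ : ℕ}

/-- The generator `u_{i,n}` of `R_ℓ`. -/
def u (p : Fin ℓ × ℤ) : DiffPoly k ℓ := FreeAlgebra.ι k p

/-- The generator `u_{i,n}` of the de Rham algebra. -/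
def uΩ (p : Fin ℓ × ℤ) : DeRham k ℓ := FreeAlgebra.ι k (Sum.inl p)

/-- The generator `δu_{i,n}` of the de Rham algebra. -/
def du (p : Fin ℓ × ℤ) : DeRham k ℓ := FreeAlgebra.ι k (Sum.inr p)

/-- The inclusion of `R_ℓ` in the de Rham algebra. -/
def incl : DiffPoly k ℓ →ₐ[k] DeRham k ℓ := FreeAlgebra.lift k uΩ

/-! ### The automorphism `S` -/

/-- The algebra homomorphism of `R_ℓ` with `u_{i,m} ↦ u_{i,m+n}`. -/
def shiftHom (n : ℤ) : DiffPoly k ℓ →ₐ[k] DiffPoly k ℓ :=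
  FreeAlgebra.lift k fun p => u (p.1, p.2 + n)

/-- The automorphism `S` of `R_ℓ`, given by `u_{i,n} ↦ u_{i,n+1}`. -/
def S : DiffPoly k ℓ ≃ₐ[k] DiffPoly k ℓ :=
  AlgEquiv.ofAlgHom (shiftHom 1) (shiftHom (-1))
    (by ext p; simp [shiftHom, u]) (by ext p; simp [shiftHom, u])

theorem S_u (i : Fin ℓ) (n : ℤ) : S (u (i, n) : DiffPoly k ℓ) = u (i, n + 1) := by
  simp [S, shiftHom, u]

/-- The extension of `S` to the de Rham algebra: `u_{i,n} ↦ u_{i,n+1}`, `δu_{i,n} ↦ δu_{i,n+1}`. -/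
def SΩ : DeRham k ℓ →ₐ[k] DeRham k ℓ :=
  FreeAlgebra.lift k (Sum.elim (fun p => uΩ (p.1, p.2 + 1)) (fun p => du (p.1, p.2 + 1)))

/-- `S ^ n`, `n ∈ ℤ`, acting diagonally on `R_ℓ ⊗ R_ℓ`. -/
def Spow2 (n : ℤ) :
    DiffPoly k ℓ ⊗[k] DiffPoly k ℓ →ₗ[k] DiffPoly k ℓ ⊗[k] DiffPoly k ℓ :=
  TensorProduct.map ((S ^ n : DiffPoly k ℓ ≃ₐ[k] DiffPoly k ℓ).toLinearMap)
    ((S ^ n : DiffPoly k ℓ ≃ₐ[k] DiffPoly k ℓ).toLinearMap)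

/-- The flip `(a ⊗ b)^σ = b ⊗ a`. -/
def flip2 :
    DiffPoly k ℓ ⊗[k] DiffPoly k ℓ →ₗ[k] DiffPoly k ℓ ⊗[k] DiffPoly k ℓ :=
  (TensorProduct.comm k (DiffPoly k ℓ) (DiffPoly k ℓ)).toLinearMap

/-- The multiplication map `m (a ⊗ b) = a b`. -/
def mult : DiffPoly k ℓ ⊗[k] DiffPoly k ℓ →ₗ[k] DiffPoly k ℓ :=
  LinearMap.mul' k (DiffPoly k ℓ)

/-! ### The partial derivatives -/

/-- Auxiliary homomorphism `f ↦ !![f ⊗ 1, ∂f/∂u_p; 0, 1 ⊗ f]`; it being multiplicative is the same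
as its upper right entry being a `2`-fold derivation. -/
def pdHom (p : Fin ℓ × ℤ) :
    DiffPoly k ℓ →ₐ[k] Matrix (Fin 2) (Fin 2) (DiffPoly k ℓ ⊗[k] DiffPoly k ℓ) :=
  FreeAlgebra.lift k fun q =>
    !![u q ⊗ₜ[k] 1, if q = p then 1 ⊗ₜ[k] 1 else 0; 0, 1 ⊗ₜ[k] u q]

/-- The partial derivative `∂/∂u_{i,n} : R_ℓ → R_ℓ ⊗ R_ℓ`, with `p = (i, n)`: the `2`-fold
derivation with `∂u_{j,m}/∂u_{i,n} = δ_{ij} δ_{mn} 1 ⊗ 1`. -/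
def pd (p : Fin ℓ × ℤ) : DiffPoly k ℓ →ₗ[k] DiffPoly k ℓ ⊗[k] DiffPoly k ℓ where
  toFun f := pdHom p f 0 1
  map_add' f g := by simp
  map_smul' c f := by simp

theorem pdHom_apply (p : Fin ℓ × ℤ) (f : DiffPoly k ℓ) :
    pdHom p f = !![f ⊗ₜ[k] 1, pd p f; 0, 1 ⊗ₜ[k] f] := by
  suffices h : pdHom p f 0 0 = f ⊗ₜ[k] 1 ∧ pdHom p f 1 0 = 0 ∧ pdHom p f 1 1 = 1 ⊗ₜ[k] f by
    ext i j
    fin_cases i <;> fin_cases j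
    · exact h.1
    · rfl
    · exact h.2.1
    · exact h.2.2
  induction f using FreeAlgebra.induction with
  | grade0 r =>
    simp [Algebra.algebraMap_eq_smul_one, TensorProduct.smul_tmul']
    rw [← TensorProduct.smul_tmul', Algebra.TensorProduct.one_def]
  | grade1 q => simp [pdHom, u]
  | mul a b ha hb => simp [Matrix.mul_apply, Fin.sum_univ_two, ha, hb]
  | add a b ha hb => simp [ha, hb, TensorProduct.add_tmul, TensorProduct.tmul_add]

theorem pd_mul (p : Fin ℓ × ℤ) (f g : DiffPoly k ℓ) :
    pd p (f * g) = (f ⊗ₜ[k] 1) * pd p g + pd p f * (1 ⊗ₜ[k] g) := by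
  have h : pdHom p (f * g) 0 1 = (pdHom p f * pdHom p g) 0 1 := by rw [map_mul]
  simpa [pdHom_apply, Matrix.mul_apply, Fin.sum_univ_two] using h

theorem pd_u (p q : Fin ℓ × ℤ) :
    pd p (u q : DiffPoly k ℓ) = if q = p then 1 ⊗ₜ[k] 1 else 0 := by
  simp [pd, pdHom, u]

theorem pd_algebraMap (p : Fin ℓ × ℤ) (r : k) :
    pd p (algebraMap k (DiffPoly k ℓ) r) = 0 := by
  simp [pd, Matrix.algebraMap_matrix_apply]

/-- The partial derivative of a monomial: remove in turn every occurrence of the letter and split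
the word there. -/
theorem pd_monomial (p : Fin ℓ × ℤ) (w : List (Fin ℓ × ℤ)) :
    pd p ((w.map u).prod : DiffPoly k ℓ) =
      ∑ j ∈ Finset.range w.length, if w[j]? = some p then
        ((w.take j).map u).prod ⊗ₜ[k] ((w.drop (j + 1)).map u).prod else 0 := by
  induction w with
  | nil => simpa using pd_algebraMap (k := k) p 1
  | cons q w ih =>
    rw [List.map_cons, List.prod_cons, pd_mul, ih, pd_u, List.length_cons,
      Finset.sum_range_succ', Finset.mul_sum]
    congr 1
    · refine Finset.sum_congr rfl fun j _ => ?_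
      by_cases h : w[j]? = some p <;> simp [h]
    · by_cases h : q = p <;> simp [h]

/-- All but finitely many partial derivatives of a given `f` vanish, so the sums over
`n ∈ ℤ` below are finite sums. -/
theorem pd_finite (f : DiffPoly k ℓ) : {p : Fin ℓ × ℤ | pd p f ≠ 0}.Finite := by
  induction f using FreeAlgebra.induction with
  | grade0 r => simp [pd_algebraMap]
  | grade1 q =>
    refine (Set.finite_singleton q).subset fun p hp => ?_
    by_contra hne
    exact hp ((pd_u p q).trans (if_neg fun h => hne h.symm))
  | mul a b ha hb =>
    refine (ha.union hb).subset fun p hp => ?_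
    by_contra hne
    simp only [Set.mem_union, Set.mem_ofPred_eq, not_or, not_not] at hne
    exact hp (by rw [pd_mul, hne.1, hne.2]; simp)
  | add a b ha hb =>
    refine (ha.union hb).subset fun p hp => ?_
    by_contra hne
    simp only [Set.mem_union, Set.mem_ofPred_eq, not_or, not_not] at hne
    exact hp (by rw [map_add, hne.1, hne.2]; simp)

/-- The difference variational derivative `δf/δu_i = ∑_{n ∈ ℤ} S^{-n} (∂f/∂u_{i,n})`. -/
def varDer (i : Fin ℓ) (f : DiffPoly k ℓ) : DiffPoly k ℓ ⊗[k] DiffPoly k ℓ :=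
  ∑ᶠ n : ℤ, Spow2 (-n) (pd (i, n) f)

/-! ### The de Rham differential -/

/-- The parity automorphism of the de Rham superalgebra: multiplication by `(-1)^p` in degree
`p`. -/
def parity : DeRham k ℓ →ₐ[k] DeRham k ℓ :=
  FreeAlgebra.lift k (Sum.elim uΩ (fun p => -du p))

/-- Auxiliary homomorphism `ω ↦ !![(-1)^p(ω) ω, δω; 0, ω]`; it being multiplicative is the same as
its upper right entry being an odd derivation. -/
def dHom : DeRham k ℓ →ₐ[k] Matrix (Fin 2) (Fin 2) (DeRham k ℓ) :=
  FreeAlgebra.lift k (Sum.elim (fun p => !![uΩ p, du p; 0, uΩ p])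
    (fun p => !![-du p, 0; 0, du p]))

/-- The de Rham differential: the odd derivation with `δ(u_{i,n}) = δu_{i,n}` and
`δ(δu_{i,n}) = 0`. -/
def d : DeRham k ℓ →ₗ[k] DeRham k ℓ where
  toFun ω := dHom ω 0 1
  map_add' f g := by simp
  map_smul' c f := by simp

theorem dHom_apply (ω : DeRham k ℓ) : dHom ω = !![parity ω, d ω; 0, ω] := by
  suffices h : dHom ω 0 0 = parity ω ∧ dHom ω 1 0 = 0 ∧ dHom ω 1 1 = ω by
    ext i j
    fin_cases i <;> fin_cases j
    · exact h.1
    · rfl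
    · exact h.2.1
    · exact h.2.2
  induction ω using FreeAlgebra.induction with
  | grade0 r => simp [Matrix.algebraMap_matrix_apply]
  | grade1 q => cases q <;> simp [dHom, parity, uΩ, du]
  | mul a b ha hb => simp [Matrix.mul_apply, Fin.sum_univ_two, ha, hb]
  | add a b ha hb => simp [ha, hb]

/-- `δ` is an odd derivation. -/
theorem d_mul (a b : DeRham k ℓ) : d (a * b) = parity a * d b + d a * b := by
  have h : dHom (a * b) 0 1 = (dHom a * dHom b) 0 1 := by rw [map_mul]
  simpa [dHom_apply, Matrix.mul_apply, Fin.sum_univ_two] using h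

theorem d_uΩ (p : Fin ℓ × ℤ) : d (uΩ p : DeRham k ℓ) = du p := by
  simp [d, dHom, uΩ]

theorem d_du (p : Fin ℓ × ℤ) : d (du p : DeRham k ℓ) = 0 := by
  simp [d, dHom, du]

theorem d_algebraMap (r : k) : d (algebraMap k (DeRham k ℓ) r) = 0 := by
  simp [d, Matrix.algebraMap_matrix_apply]

theorem d_one : d (1 : DeRham k ℓ) = 0 := by
  simpa using d_algebraMap (k := k) (ℓ := ℓ) 1

/-- `δ² = 0`. -/
theorem d_d (ω : DeRham k ℓ) : d (d ω) = 0 := by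
  have hp : ∀ a : DeRham k ℓ, parity (d a) = -d (parity a) := by
    intro a
    induction a using FreeAlgebra.induction with
    | grade0 r => simp [d_algebraMap]
    | grade1 q =>
      rcases q with q | q
      · change parity (d (uΩ q)) = -d (parity (uΩ q))
        have h : parity (uΩ q : DeRham k ℓ) = uΩ q := by simp [parity, uΩ]
        rw [h, d_uΩ]
        simp [parity, du]
      · change parity (d (du q)) = -d (parity (du q))
        have h : parity (du q : DeRham k ℓ) = -du q := by simp [parity, du]
        rw [h, map_neg, d_du]
        simp
    | mul a b ha hb =>
      simp only [d_mul, map_add, map_mul, ha, hb]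
      simp only [mul_neg, neg_mul, neg_add]
    | add a b ha hb => rw [map_add, map_add, map_add, map_add, ha, hb, neg_add]
  induction ω using FreeAlgebra.induction with
  | grade0 r => simp [d_algebraMap]
  | grade1 q =>
    rcases q with q | q
    · change d (d (uΩ q)) = 0
      rw [d_uΩ, d_du]
    · change d (d (du q)) = 0
      rw [d_du, map_zero]
  | mul a b ha hb => rw [d_mul, map_add, d_mul, d_mul, hp, ha, hb]; simp
  | add a b ha hb => rw [map_add, map_add, ha, hb, add_zero]

/-- `a ⊗ b ↦ a δu_{i,n} b`. -/
def sandwich (p : Fin ℓ × ℤ) : DiffPoly k ℓ ⊗[k] DiffPoly k ℓ →ₗ[k] DeRham k ℓ :=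
  TensorProduct.lift
    (((LinearMap.mul k (DeRham k ℓ)).comp
      ((LinearMap.mulRight k (du p)).comp incl.toLinearMap)).compl₂ incl.toLinearMap)

theorem sandwich_tmul (p : Fin ℓ × ℤ) (a b : DiffPoly k ℓ) :
    sandwich p (a ⊗ₜ[k] b) = incl a * du p * incl b := by
  simp [sandwich]

/-- On functions, `δf = ∑_{i,n} (∂f/∂u_{i,n})' δu_{i,n} (∂f/∂u_{i,n})''`. -/
theorem d_incl (f : DiffPoly k ℓ) : d (incl f) = ∑ᶠ p, sandwich p (pd p f) := by
  have fin : ∀ f : DiffPoly k ℓ, (Function.support fun p => sandwich p (pd p f)).Finite :=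
    fun f => (pd_finite f).subset fun p hp h => hp (by simp [h])
  have par : ∀ f : DiffPoly k ℓ, parity (incl f) = incl f := fun f =>
    DFunLike.congr_fun (f := (parity.comp incl : DiffPoly k ℓ →ₐ[k] DeRham k ℓ)) (g := incl)
      (by ext p; simp [parity, incl, uΩ]) f
  have hl : ∀ (p : Fin ℓ × ℤ) (a : DiffPoly k ℓ) (t : DiffPoly k ℓ ⊗[k] DiffPoly k ℓ),
      sandwich p ((a ⊗ₜ[k] 1) * t) = incl a * sandwich p t := by
    intro p a t
    induction t with
    | zero => simp
    | tmul x y => simp [sandwich_tmul, mul_assoc]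
    | add x y hx hy => rw [mul_add, map_add, hx, hy, map_add, mul_add]
  have hr : ∀ (p : Fin ℓ × ℤ) (a : DiffPoly k ℓ) (t : DiffPoly k ℓ ⊗[k] DiffPoly k ℓ),
      sandwich p (t * (1 ⊗ₜ[k] a)) = sandwich p t * incl a := by
    intro p a t
    induction t with
    | zero => simp
    | tmul x y => simp [sandwich_tmul, mul_assoc]
    | add x y hx hy => rw [add_mul, map_add, hx, hy, map_add, add_mul]
  induction f using FreeAlgebra.induction with
  | grade0 r => simp [pd_algebraMap, d_algebraMap]
  | grade1 q =>
    have h1 : (FreeAlgebra.ι k q : DiffPoly k ℓ) = u q := rfl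
    have h2 : incl (u q : DiffPoly k ℓ) = uΩ q := by simp [incl, u]
    rw [h1, h2, d_uΩ, finsum_eq_single _ q]
    · simp [pd_u, sandwich_tmul]
    · intro p hp
      simp [pd_u, hp.symm]
  | mul a b ha hb =>
    have e : ∀ p, sandwich p (pd p (a * b)) =
        incl a * sandwich p (pd p b) + sandwich p (pd p a) * incl b := fun p => by
      rw [pd_mul, map_add, hl, hr]
    rw [map_mul, d_mul, par, ha, hb, mul_finsum' _ _ (fin b), finsum_mul' _ _ (fin a),
      ← finsum_add_distrib]
    · exact finsum_congr fun p => (e p).symm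
    · exact (fin b).subset fun p hp h => hp (by simp [h])
    · exact (fin a).subset fun p hp h => hp (by simp [h])
  | add a b ha hb =>
    rw [map_add, map_add, ha, hb, ← finsum_add_distrib (fin a) (fin b)]
    exact finsum_congr fun p => by rw [map_add, map_add]

/-! ### The variational complex -/

/-- The subspace of elements of degree `p`: the span of the words with exactly `p` letters of the
form `δu_{i,n}`. -/
def homog (k : Type*) [Field k] (ℓ : ℕ) (p : ℕ) : Submodule k (DeRham k ℓ) :=
  Submodule.span k {ω | ∃ w : List ((Fin ℓ × ℤ) ⊕ (Fin ℓ × ℤ)),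
    w.countP Sum.isRight = p ∧ ω = (w.map (FreeAlgebra.ι k)).prod}

/-- The commutator subspace of the superalgebra: the span of the supercommutators
`[a, b] = ab - (-1)^{p(a)p(b)} ba` of homogeneous elements. -/
def superComm (k : Type*) [Field k] (ℓ : ℕ) : Submodule k (DeRham k ℓ) :=
  Submodule.span k {ω | ∃ (p q : ℕ) (a b : DeRham k ℓ), a ∈ homog k ℓ p ∧ b ∈ homog k ℓ q ∧
    ω = a * b - (-1 : DeRham k ℓ) ^ (p * q) * (b * a)}

/-- The subspace `(S - 1)Ω + [Ω, Ω]` of the de Rham algebra `Ω`. -/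
def varRel (k : Type*) [Field k] (ℓ : ℕ) : Submodule k (DeRham k ℓ) :=
  LinearMap.range ((SΩ : DeRham k ℓ →ₐ[k] DeRham k ℓ).toLinearMap - LinearMap.id) ⊔
    superComm k ℓ

theorem parity_homog {p : ℕ} {a : DeRham k ℓ} (ha : a ∈ homog k ℓ p) :
    parity a = (-1 : DeRham k ℓ) ^ p * a := by
  induction ha using Submodule.span_induction with
  | mem x hx =>
    obtain ⟨w, rfl, rfl⟩ := hx
    induction w with
    | nil => simp
    | cons q w ih =>
      rcases q with q | q
      · have hc : ∀ n : ℕ, (-1 : DeRham k ℓ) ^ n * FreeAlgebra.ι k (Sum.inl q) =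
            FreeAlgebra.ι k (Sum.inl q) * (-1) ^ n := fun n =>
          ((Commute.neg_one_left _).pow_left n).eq
        have hq : parity (FreeAlgebra.ι k (Sum.inl q) : DeRham k ℓ) =
            FreeAlgebra.ι k (Sum.inl q) := by simp [parity, uΩ]
        rw [List.map_cons, List.prod_cons, map_mul, ih, hq, ← mul_assoc, ← mul_assoc, ← hc]
        simp
      · have hc : ∀ n : ℕ, (-1 : DeRham k ℓ) ^ n * FreeAlgebra.ι k (Sum.inr q) =
            FreeAlgebra.ι k (Sum.inr q) * (-1) ^ n := fun n =>
          ((Commute.neg_one_left _).pow_left n).eq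
        have hq : parity (FreeAlgebra.ι k (Sum.inr q) : DeRham k ℓ) =
            -FreeAlgebra.ι k (Sum.inr q) := by simp [parity, du]
        rw [List.map_cons, List.prod_cons, map_mul, ih, hq, ← mul_assoc, ← mul_assoc, neg_mul,
          ← hc]
        simp [List.countP_cons, pow_succ]
  | zero => simp
  | add x y _ _ hx hy => rw [map_add, hx, hy, mul_add]
  | smul c x _ hx => rw [map_smul, hx, mul_smul_comm]

theorem mul_homog {p q : ℕ} {a b : DeRham k ℓ} (ha : a ∈ homog k ℓ p) (hb : b ∈ homog k ℓ q) :
    a * b ∈ homog k ℓ (p + q) := by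
  have h := Submodule.mul_mem_mul ha hb
  rw [homog, homog, Submodule.span_mul_span] at h
  refine Submodule.span_mono ?_ h
  rintro _ ⟨_, ⟨w, rfl, rfl⟩, _, ⟨v, rfl, rfl⟩, rfl⟩
  exact ⟨w ++ v, by simp, by simp⟩

theorem d_homog {p : ℕ} {a : DeRham k ℓ} (ha : a ∈ homog k ℓ p) : d a ∈ homog k ℓ (p + 1) := by
  induction ha using Submodule.span_induction with
  | mem x hx =>
    obtain ⟨w, rfl, rfl⟩ := hx
    induction w with
    | nil => simp [d_one]
    | cons q w ih =>
      have hw : ((w.map (FreeAlgebra.ι k)).prod : DeRham k ℓ) ∈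
          homog k ℓ (w.countP Sum.isRight) := Submodule.subset_span ⟨w, rfl, rfl⟩
      rw [List.map_cons, List.prod_cons, d_mul]
      rcases q with q | q
      · have h0 : (uΩ q : DeRham k ℓ) ∈ homog k ℓ 0 :=
          Submodule.subset_span ⟨[Sum.inl q], by simp, by simp [uΩ]⟩
        have h1 : (du q : DeRham k ℓ) ∈ homog k ℓ 1 :=
          Submodule.subset_span ⟨[Sum.inr q], by simp, by simp [du]⟩
        change parity (uΩ q) * _ + d (uΩ q) * _ ∈ _
        rw [d_uΩ, parity_homog h0]
        refine Submodule.add_mem _ ?_ ?_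
        · have := mul_homog h0 ih
          simpa [add_comm, add_left_comm] using this
        · have := mul_homog h1 hw
          simpa [add_comm, add_left_comm] using this
      · have h1 : (du q : DeRham k ℓ) ∈ homog k ℓ 1 :=
          Submodule.subset_span ⟨[Sum.inr q], by simp, by simp [du]⟩
        change parity (du q) * _ + d (du q) * _ ∈ _
        rw [d_du, parity_homog h1]
        have := Submodule.neg_mem _ (mul_homog h1 ih)
        simpa [List.countP_cons, add_comm, add_left_comm] using this
  | zero => simp
  | add x y _ _ hx hy => rw [map_add]; exact Submodule.add_mem _ hx hy
  | smul c x _ hx => rw [map_smul]; exact Submodule.smul_mem _ _ hx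

theorem d_SΩ (ω : DeRham k ℓ) : d (SΩ ω) = SΩ (d ω) := by
  have par : ∀ a : DeRham k ℓ, parity (SΩ a) = SΩ (parity a) := fun a =>
    DFunLike.congr_fun (f := (parity.comp SΩ : DeRham k ℓ →ₐ[k] DeRham k ℓ))
      (g := SΩ.comp parity)
      (by ext p; rcases p with p | p <;> simp [parity, SΩ, uΩ, du]) a
  induction ω using FreeAlgebra.induction with
  | grade0 r => simp [d_algebraMap]
  | grade1 q =>
    rcases q with q | q
    · change d (SΩ (uΩ q)) = SΩ (d (uΩ q))
      have h1 : SΩ (uΩ q : DeRham k ℓ) = uΩ (q.1, q.2 + 1) := by simp [SΩ, uΩ]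
      have h2 : SΩ (du q : DeRham k ℓ) = du (q.1, q.2 + 1) := by simp [SΩ, du]
      rw [h1, d_uΩ, d_uΩ, h2]
    · change d (SΩ (du q)) = SΩ (d (du q))
      have h2 : SΩ (du q : DeRham k ℓ) = du (q.1, q.2 + 1) := by simp [SΩ, du]
      rw [h2, d_du, d_du, map_zero]
  | mul a b ha hb => rw [map_mul, d_mul, d_mul, ha, hb, par, map_add, map_mul, map_mul]
  | add a b ha hb => rw [map_add, map_add, map_add, ha, hb, map_add]

theorem neg_one_pow_mul_d (n : ℕ) (a : DeRham k ℓ) :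
    d ((-1 : DeRham k ℓ) ^ n * a) = (-1) ^ n * d a := by
  rcases neg_one_pow_eq_or (DeRham k ℓ) n with h | h <;> simp [h]

/-- `δ` preserves the subspace by which one divides. -/
theorem varRel_le_comap : varRel k ℓ ≤ (varRel k ℓ).comap d := by
  refine sup_le ?_ ?_
  · rintro _ ⟨ω, rfl⟩
    refine Submodule.mem_sup_left ⟨d ω, ?_⟩
    simp [d_SΩ]
  · refine Submodule.span_le.2 ?_
    rintro _ ⟨p, q, a, b, ha, hb, rfl⟩
    refine Submodule.mem_sup_right ?_
    have h1 : d a * b - (-1 : DeRham k ℓ) ^ ((p + 1) * q) * (b * d a) ∈ superComm k ℓ :=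
      Submodule.subset_span ⟨_, _, _, _, d_homog ha, hb, rfl⟩
    have h2 : a * d b - (-1 : DeRham k ℓ) ^ (p * (q + 1)) * (d b * a) ∈ superComm k ℓ :=
      Submodule.subset_span ⟨_, _, _, _, ha, d_homog hb, rfl⟩
    have key : d (a * b - (-1 : DeRham k ℓ) ^ (p * q) * (b * a)) =
        (d a * b - (-1 : DeRham k ℓ) ^ ((p + 1) * q) * (b * d a)) +
        (-1 : k) ^ p • (a * d b - (-1 : DeRham k ℓ) ^ (p * (q + 1)) * (d b * a)) := by
      rw [map_sub, neg_one_pow_mul_d, d_mul, d_mul, parity_homog ha, parity_homog hb]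
      rcases Nat.even_or_odd p with ep | ep <;> rcases Nat.even_or_odd q with eq | eq
      · have e3 : Even (p * q) := ep.mul_right q
        have e4 : Even ((p + 1) * q) := eq.mul_left _
        have e5 : Even (p * (q + 1)) := ep.mul_right _
        simp only [ep.neg_one_pow, eq.neg_one_pow, e3.neg_one_pow, e4.neg_one_pow,
          e5.neg_one_pow, one_mul, one_smul]
        abel
      · have e3 : Even (p * q) := ep.mul_right q
        have e4 : Odd ((p + 1) * q) := ep.add_one.mul eq
        have e5 : Even (p * (q + 1)) := ep.mul_right _
        simp only [ep.neg_one_pow, eq.neg_one_pow, e3.neg_one_pow, e4.neg_one_pow,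
          e5.neg_one_pow, one_mul, one_smul, neg_mul]
        abel
      · have e3 : Even (p * q) := eq.mul_left p
        have e4 : Even ((p + 1) * q) := eq.mul_left _
        have e5 : Odd (p * (q + 1)) := ep.mul eq.add_one
        simp only [ep.neg_one_pow, eq.neg_one_pow, e3.neg_one_pow, e4.neg_one_pow,
          e5.neg_one_pow, one_mul, neg_smul, one_smul, neg_mul]
        abel
      · have e3 : Odd (p * q) := ep.mul eq
        have e4 : Even ((p + 1) * q) := ep.add_one.mul_right _
        have e5 : Even (p * (q + 1)) := eq.add_one.mul_left _
        simp only [ep.neg_one_pow, eq.neg_one_pow, e3.neg_one_pow, e4.neg_one_pow,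
          e5.neg_one_pow, one_mul, neg_smul, one_smul, neg_mul]
        abel
    change d _ ∈ _
    rw [key]
    exact Submodule.add_mem _ h1 (Submodule.smul_mem _ _ h2)

/-- The variational complex `Ω(R_ℓ) = Ω / ((S - 1)Ω + [Ω, Ω])`, where `Ω` is the de Rham algebra. -/
abbrev VarComplex (k : Type*) [Field k] (ℓ : ℕ) : Type _ := DeRham k ℓ ⧸ varRel k ℓ

/-- The differential of the variational complex, induced by `δ`. -/
def dVar : VarComplex k ℓ →ₗ[k] VarComplex k ℓ :=
  Submodule.mapQ (varRel k ℓ) (varRel k ℓ) d varRel_le_comap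

theorem dVar_dVar (x : VarComplex k ℓ) : dVar (dVar x) = 0 := by
  obtain ⟨ω, rfl⟩ := Submodule.mkQ_surjective _ x
  simp [dVar, d_d]

/-- The `0`-form `∫ f`: the class of `f ∈ R_ℓ`. -/
def zeroForm (f : DiffPoly k ℓ) : VarComplex k ℓ := (varRel k ℓ).mkQ (incl f)

/-- The `1`-form given by `F = (F_i) ∈ R_ℓ^ℓ`: the class of `∑_i F_i δu_i`. -/
def oneForm (F : Fin ℓ → DiffPoly k ℓ) : VarComplex k ℓ :=
  (varRel k ℓ).mkQ (∑ i, incl (F i) * du (i, 0))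

/-- Arrays `A_{ij}(λ)` with entries in `(R_ℓ ⊗ R_ℓ)[λ, λ⁻¹]`. -/
abbrev Array2 (k : Type*) [Field k] (ℓ : ℕ) : Type _ :=
  Fin ℓ → Fin ℓ → LaurentPolynomial (DiffPoly k ℓ ⊗[k] DiffPoly k ℓ)

/-- The operation `A(λ) = ∑ a_n λ^n ↦ (|_{x=S} A((λx)⁻¹))^σ = ∑ S^{-n}(a_n^σ) λ^{-n}`. -/
def adj (A : LaurentPolynomial (DiffPoly k ℓ ⊗[k] DiffPoly k ℓ)) :
    LaurentPolynomial (DiffPoly k ℓ ⊗[k] DiffPoly k ℓ) :=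
  A.coeff.sum fun n a => AddMonoidAlgebra.single (-n) (Spow2 (-n) (flip2 a))

/-- The skewadjointness condition defining the arrays that describe `2`-forms. -/
def IsSkewadjoint (A : Array2 k ℓ) : Prop := ∀ i j, A i j = -adj (A j i)

/-- The `2`-form given by the array `A_{ij}(λ) = ∑_n A_{ij}^n λ^n`: the class of
`∑_{i,j,n} (A_{ij}^n)' δu_{i,n} (A_{ij}^n)'' δu_j`. -/
def twoForm (A : Array2 k ℓ) : VarComplex k ℓ :=
  (varRel k ℓ).mkQ (∑ i, ∑ j, (A i j).coeff.sum fun n a => sandwich (i, n) a * du (j, 0))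

/-- The array `½ ∑_{n ∈ ℤ} (∂F_j/∂u_{i,n} λ^n - (λS)^{-n} (∂F_i/∂u_{j,n})^σ)`. -/
def curlArray (F : Fin ℓ → DiffPoly k ℓ) : Array2 k ℓ := fun i j =>
  (2⁻¹ : k) • ∑ᶠ n : ℤ, (AddMonoidAlgebra.single n (pd (i, n) (F j)) -
    AddMonoidAlgebra.single (-n) (Spow2 (-n) (flip2 (pd (j, n) (F i)))))

/-- The subspace `k + [R_ℓ, R_ℓ] + (S - 1)R_ℓ` of `R_ℓ`. -/
def trivialFunctions (k : Type*) [Field k] (ℓ : ℕ) : Submodule k (DiffPoly k ℓ) :=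
  LinearMap.range (Algebra.linearMap k (DiffPoly k ℓ)) ⊔
    Submodule.span k {h | ∃ a b : DiffPoly k ℓ, h = a * b - b * a} ⊔
    LinearMap.range ((S : DiffPoly k ℓ ≃ₐ[k] DiffPoly k ℓ).toLinearMap - LinearMap.id)

end NCDiff

end

/-! Contraction with the Euler vector field gives a Poincaré lemma for the variational complex. Let
`contr` be the odd derivation with δu ↦ u and u ↦ 0. The anticommutator of `d` and `contr` is an
even derivation fixing every letter, so it multiplies each word by its length (`cartan_word`). In
characteristic 0 the length of a non-empty word is invertible. Both `contr` and division by the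
length (`lenInv`) preserve `varRel`: the relations between words are homogeneous in length, and an
odd derivation commuting with S sends supercommutators to combinations of supercommutators. So a
closed class is a constant plus an exact class (`sub_d_contr_mem_varRel`).

What remains is to read this in coordinates. In degree 0 the homotopy term vanishes, only constants
survive, and projecting `varRel` to degree 0 shows which functions have trivial class. In degrees 1
and 2, rotating and shifting words brings forms to the normal shapes `oneForm` and `twoForm`, where
`d` becomes the variational derivative (`dVar_zeroForm`) and the Jacobian array (`dVar_oneForm`).

To pass from equality of classes to equality of coefficients, the functional `cycFun t` counts with
signs the rotations of a word that equal `t` up to a shift; it vanishes on `varRel`. In a 1-form the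
only δu marks both the starting point and the shift, so F is recovered completely. In a 2-form
either of two δu's may stand last, so only A − adj(Aᵗ) is recovered; for skewadjoint A this is 2A,
which is the origin of the factor ½. -/

noncomputable section

namespace NCDiff

/-! ### Words -/

section Words

variable {k : Type*} [Field k] {X : Type*}

variable (k) in
/-- The monomial of the free algebra given by a word. -/
def word (w : List X) : FreeAlgebra k X := (w.map (FreeAlgebra.ι k)).prod

@[simp] theorem word_nil : word k ([] : List X) = 1 := rfl

theorem word_cons (x : X) (w : List X) : word k (x :: w) = FreeAlgebra.ι k x * word k w := by
  simp [word]

theorem word_append (v w : List X) : word k (v ++ w) = word k v * word k w := by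
  simp [word]

theorem word_singleton (x : X) : word k [x] = FreeAlgebra.ι k x := by simp [word]

theorem basisFreeMonoid_apply (w : FreeMonoid X) :
    FreeAlgebra.basisFreeMonoid k X w = word k w.toList := by
  simp [FreeAlgebra.basisFreeMonoid, FreeAlgebra.equivMonoidAlgebraFreeMonoid, word,
    FreeMonoid.lift_apply, MonoidAlgebra.coeffLinearEquiv]

variable (k X) in
/-- The basis of the free algebra consisting of the words. -/
def wordBasis : Module.Basis (List X) k (FreeAlgebra k X) :=
  (FreeAlgebra.basisFreeMonoid k X).reindex FreeMonoid.toList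

theorem wordBasis_apply (w : List X) : wordBasis k X w = word k w := by
  simp [wordBasis, basisFreeMonoid_apply]

variable {M : Type*} [AddCommGroup M] [Module k M]

/-- The linear map on the free algebra with given values on words. -/
def wordLift (g : List X → M) : FreeAlgebra k X →ₗ[k] M := (wordBasis k X).constr k g

@[simp] theorem wordLift_word (g : List X → M) (w : List X) : wordLift g (word k w) = g w := by
  rw [← wordBasis_apply, wordLift, Module.Basis.constr_basis]

theorem word_hom_ext {f g : FreeAlgebra k X →ₗ[k] M} (h : ∀ w, f (word k w) = g (word k w)) :
    f = g :=
  (wordBasis k X).ext fun w => by rw [wordBasis_apply, h]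

theorem word_induction {P : FreeAlgebra k X → Prop} (hw : ∀ w, P (word k w)) (h0 : P 0)
    (ha : ∀ a b, P a → P b → P (a + b)) (hs : ∀ (c : k) a, P a → P (c • a)) (a) : P a := by
  have : a ∈ Submodule.span k (Set.range (wordBasis k X)) := by simp [Module.Basis.span_eq]
  induction this using Submodule.span_induction with
  | mem x hx => obtain ⟨w, rfl⟩ := hx; rw [wordBasis_apply]; exact hw w
  | zero => exact h0
  | add x y _ _ hx hy => exact ha _ _ hx hy
  | smul c x _ hx => exact hs _ _ hx

end Words

/-! ### Words in the de Rham algebra and the relations between them -/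

variable {k : Type*} [Field k] {ℓ : ℕ}

/-- The letters of the de Rham algebra. -/
abbrev Letter (ℓ : ℕ) : Type := (Fin ℓ × ℤ) ⊕ (Fin ℓ × ℤ)

/-- The number of letters `δu_{i,n}` in a word. -/
abbrev deg (w : List (Letter ℓ)) : ℕ := w.countP Sum.isRight

theorem word_mem_homog (w : List (Letter ℓ)) : word k w ∈ homog k ℓ (deg w) :=
  Submodule.subset_span ⟨w, rfl, rfl⟩

/-- Translation of a letter by `n`. -/
def shiftLetter (n : ℤ) : Letter ℓ → Letter ℓ :=
  Sum.map (fun p => (p.1, p.2 + n)) (fun p => (p.1, p.2 + n))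

@[simp] theorem shiftLetter_inl (n : ℤ) (p : Fin ℓ × ℤ) :
    shiftLetter n (Sum.inl p) = Sum.inl (p.1, p.2 + n) := rfl

@[simp] theorem shiftLetter_inr (n : ℤ) (p : Fin ℓ × ℤ) :
    shiftLetter n (Sum.inr p) = Sum.inr (p.1, p.2 + n) := rfl

theorem shiftLetter_shiftLetter (m n : ℤ) (x : Letter ℓ) :
    shiftLetter m (shiftLetter n x) = shiftLetter (n + m) x := by
  rcases x with x | x <;> simp [add_assoc]

theorem shiftLetter_zero : (shiftLetter 0 : Letter ℓ → Letter ℓ) = id := by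
  funext x; rcases x with x | x <;> simp

theorem map_shiftLetter_map (m n : ℤ) (w : List (Letter ℓ)) :
    (w.map (shiftLetter n)).map (shiftLetter m) = w.map (shiftLetter (n + m)) := by
  rw [List.map_map]; exact List.map_congr_left fun x _ => shiftLetter_shiftLetter m n x

theorem deg_map_shiftLetter (n : ℤ) (w : List (Letter ℓ)) : deg (w.map (shiftLetter n)) = deg w := by
  rw [deg, List.countP_map]
  exact List.countP_congr fun x _ => by rcases x with x | x <;> simp

theorem SΩ_word (w : List (Letter ℓ)) : SΩ (word k w) = word k (w.map (shiftLetter 1)) := by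
  induction w with
  | nil => simp
  | cons x w ih =>
    rw [word_cons, map_mul, ih, List.map_cons, word_cons]
    rcases x with x | x <;> simp [SΩ, uΩ, du]

theorem word_sub_mem_varRel (v w : List (Letter ℓ)) :
    word k (v ++ w) - (-1 : DeRham k ℓ) ^ (deg v * deg w) * word k (w ++ v) ∈ varRel k ℓ := by
  refine Submodule.mem_sup_right (Submodule.subset_span
    ⟨_, _, _, _, word_mem_homog v, word_mem_homog w, ?_⟩)
  rw [word_append, word_append]

theorem SΩ_sub_mem_varRel (a : DeRham k ℓ) : SΩ a - a ∈ varRel k ℓ :=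
  Submodule.mem_sup_left ⟨a, by simp⟩

theorem neg_one_pow_mul_eq_smul (n : ℕ) (a : DeRham k ℓ) :
    (-1 : DeRham k ℓ) ^ n * a = (-1 : k) ^ n • a := by
  rcases Nat.even_or_odd n with h | h <;> simp [h.neg_one_pow]

/-- To map `varRel` into a subspace it suffices to do so for the relations between words. -/
theorem varRel_le_of_words {M : Type*} [AddCommGroup M] [Module k M] (f : DeRham k ℓ →ₗ[k] M)
    (N : Submodule k M)
    (hS : ∀ w, f (word k (w.map (shiftLetter 1))) - f (word k w) ∈ N)
    (hc : ∀ v w, f (word k (v ++ w)) - (-1 : k) ^ (deg v * deg w) • f (word k (w ++ v)) ∈ N) :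
    varRel k ℓ ≤ N.comap f := by
  refine sup_le ?_ (Submodule.span_le.2 ?_)
  · rintro _ ⟨ω, rfl⟩
    induction ω using word_induction with
    | hw w => simpa [SΩ_word] using hS w
    | h0 => simp
    | ha a b ha hb => rw [map_add]; exact Submodule.add_mem _ ha hb
    | hs c a ha => rw [map_smul]; exact Submodule.smul_mem _ _ ha
  -- The supercommutator is bilinear once the degrees p and q are fixed, and each homogeneous part
  -- is spanned by words.
  · rintro _ ⟨p, q, a, b, ha, hb, rfl⟩
    simp only [neg_one_pow_mul_eq_smul]
    induction ha using Submodule.span_induction with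
    | mem x hx =>
      obtain ⟨v, rfl, rfl⟩ := hx
      induction hb using Submodule.span_induction with
      | mem y hy =>
        obtain ⟨w, rfl, rfl⟩ := hy
        simpa [word] using hc v w
      | zero => simp
      | add y z _ _ hy hz =>
        simp only [mul_add, add_mul, smul_add, add_sub_add_comm]
        exact Submodule.add_mem _ hy hz
      | smul c y _ hy =>
        simp only [mul_smul_comm, smul_mul_assoc]
        rw [smul_comm, ← smul_sub]
        exact Submodule.smul_mem _ _ hy
    | zero => simp
    | add y z _ _ hy hz =>
      simp only [mul_add, add_mul, smul_add, add_sub_add_comm]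
      exact Submodule.add_mem _ hy hz
    | smul c y _ hy =>
      simp only [mul_smul_comm, smul_mul_assoc]
      rw [smul_comm, ← smul_sub]
      exact Submodule.smul_mem _ _ hy

/-! ### The contracting homotopy -/

/-- Auxiliary homomorphism `ω ↦ !![(-1)^p(ω) ω, hω; 0, ω]`. -/
def contrHom : DeRham k ℓ →ₐ[k] Matrix (Fin 2) (Fin 2) (DeRham k ℓ) :=
  FreeAlgebra.lift k (Sum.elim (fun p => !![uΩ p, 0; 0, uΩ p])
    (fun p => !![-du p, uΩ p; 0, du p]))

/-- Contraction with the Euler vector field: the odd derivation with `δu_{i,n} ↦ u_{i,n}` and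
`u_{i,n} ↦ 0`. -/
def contr : DeRham k ℓ →ₗ[k] DeRham k ℓ where
  toFun ω := contrHom ω 0 1
  map_add' f g := by simp
  map_smul' c f := by simp

theorem contrHom_apply (ω : DeRham k ℓ) : contrHom ω = !![parity ω, contr ω; 0, ω] := by
  suffices h : contrHom ω 0 0 = parity ω ∧ contrHom ω 1 0 = 0 ∧ contrHom ω 1 1 = ω by
    ext i j
    fin_cases i <;> fin_cases j
    · exact h.1
    · rfl
    · exact h.2.1
    · exact h.2.2
  induction ω using FreeAlgebra.induction with
  | grade0 r => simp [Matrix.algebraMap_matrix_apply]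
  | grade1 q => cases q <;> simp [contrHom, parity, uΩ, du]
  | mul a b ha hb => simp [Matrix.mul_apply, Fin.sum_univ_two, ha, hb]
  | add a b ha hb => simp [ha, hb]

theorem contr_mul (a b : DeRham k ℓ) : contr (a * b) = parity a * contr b + contr a * b := by
  have h : contrHom (a * b) 0 1 = (contrHom a * contrHom b) 0 1 := by rw [map_mul]
  simpa [contrHom_apply, Matrix.mul_apply, Fin.sum_univ_two] using h

theorem contr_ι_inl (p : Fin ℓ × ℤ) :
    contr (FreeAlgebra.ι k (Sum.inl p) : DeRham k ℓ) = 0 := by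
  simp [contr, contrHom]

theorem contr_ι_inr (p : Fin ℓ × ℤ) :
    contr (FreeAlgebra.ι k (Sum.inr p) : DeRham k ℓ) = FreeAlgebra.ι k (Sum.inl p) := by
  simp [contr, contrHom, uΩ]

theorem d_ι_inl (p : Fin ℓ × ℤ) :
    d (FreeAlgebra.ι k (Sum.inl p) : DeRham k ℓ) = FreeAlgebra.ι k (Sum.inr p) := d_uΩ p

theorem d_ι_inr (p : Fin ℓ × ℤ) : d (FreeAlgebra.ι k (Sum.inr p) : DeRham k ℓ) = 0 := d_du p

theorem contr_algebraMap (r : k) : contr (algebraMap k (DeRham k ℓ) r) = 0 := by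
  simp [contr, Matrix.algebraMap_matrix_apply]

theorem contr_one : contr (1 : DeRham k ℓ) = 0 := by
  simpa using contr_algebraMap (k := k) (ℓ := ℓ) 1

theorem parity_word (w : List (Letter ℓ)) : parity (word k w) = (-1 : k) ^ deg w • word k w := by
  rw [parity_homog (word_mem_homog w), neg_one_pow_mul_eq_smul]

theorem parity_parity (a : DeRham k ℓ) : parity (parity a) = a :=
  DFunLike.congr_fun (f := (parity.comp parity : DeRham k ℓ →ₐ[k] DeRham k ℓ))
    (g := AlgHom.id k _)
    (by ext p; rcases p with p | p <;> simp [parity, uΩ, du]) a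

theorem parity_contr (a : DeRham k ℓ) : parity (contr a) = -contr (parity a) := by
  induction a using FreeAlgebra.induction with
  | grade0 r => simp [contr_algebraMap]
  | grade1 q =>
    rcases q with q | q
    · simp [contr_ι_inl, parity, uΩ]
    · simp [contr_ι_inr, parity, uΩ, du]
  | mul a b ha hb =>
    simp only [contr_mul, map_add, map_mul, ha, hb, mul_neg, neg_mul, neg_add]
  | add a b ha hb => simp only [map_add, ha, hb, neg_add]

theorem parity_d (a : DeRham k ℓ) : parity (d a) = -d (parity a) := by
  induction a using FreeAlgebra.induction with
  | grade0 r => simp [d_algebraMap]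
  | grade1 q =>
    rcases q with q | q
    · simp [d_ι_inl, parity, uΩ, du]
    · simp [d_ι_inr, parity, du]
  | mul a b ha hb =>
    simp only [d_mul, map_add, map_mul, ha, hb, mul_neg, neg_mul, neg_add]
  | add a b ha hb => simp only [map_add, ha, hb, neg_add]

theorem contr_SΩ (ω : DeRham k ℓ) : contr (SΩ ω) = SΩ (contr ω) := by
  have par : ∀ a : DeRham k ℓ, parity (SΩ a) = SΩ (parity a) := fun a =>
    DFunLike.congr_fun (f := (parity.comp SΩ : DeRham k ℓ →ₐ[k] DeRham k ℓ))
      (g := SΩ.comp parity)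
      (by ext p; rcases p with p | p <;> simp [parity, SΩ, uΩ, du]) a
  induction ω using FreeAlgebra.induction with
  | grade0 r => simp [contr_algebraMap]
  | grade1 q =>
    rcases q with q | q
    · simp [SΩ, uΩ, contr_ι_inl]
    · simp [SΩ, uΩ, du, contr_ι_inr]
  | mul a b ha hb => rw [map_mul, contr_mul, contr_mul, ha, hb, par, map_add, map_mul, map_mul]
  | add a b ha hb => rw [map_add, map_add, map_add, ha, hb, map_add]

/-- Contraction lowers the degree by one; the degree of the zero element is chosen to have the
right parity. -/
theorem contr_homog {p : ℕ} {a : DeRham k ℓ} (ha : a ∈ homog k ℓ p) :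
    contr a ∈ homog k ℓ (if p = 0 then 1 else p - 1) := by
  induction ha using Submodule.span_induction with
  | mem x hx =>
    obtain ⟨w, rfl, rfl⟩ := hx
    change contr (word k w) ∈ _
    suffices h : (deg w = 0 → contr (word k w) = 0) ∧
        (∀ p, deg w = p + 1 → contr (word k w) ∈ homog k ℓ p) by
      rcases hp : deg w with _ | p
      · rw [h.1 hp]; exact Submodule.zero_mem _
      · change _ ∈ homog k ℓ (if deg w = 0 then 1 else deg w - 1)
        rw [hp]
        exact h.2 p hp
    induction w with
    | nil => simp [contr_one]
    | cons q w ih =>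
      rw [word_cons, contr_mul]
      rcases q with q | q
      · have h0 : (FreeAlgebra.ι k (Sum.inl q) : DeRham k ℓ) ∈ homog k ℓ 0 :=
          Submodule.subset_span ⟨[Sum.inl q], by simp, by simp⟩
        rw [contr_ι_inl, parity_homog h0]
        refine ⟨fun h => ?_, fun p h => ?_⟩
        · rw [ih.1 (by simpa [deg] using h)]; simp
        · simpa using mul_homog h0 (ih.2 p (by simpa [deg, List.countP_cons] using h))
      · have h1 : (FreeAlgebra.ι k (Sum.inr q) : DeRham k ℓ) ∈ homog k ℓ 1 :=
          Submodule.subset_span ⟨[Sum.inr q], by simp, by simp⟩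
        have h0 : (FreeAlgebra.ι k (Sum.inl q) : DeRham k ℓ) ∈ homog k ℓ 0 :=
          Submodule.subset_span ⟨[Sum.inl q], by simp, by simp⟩
        rw [contr_ι_inr, parity_homog h1]
        refine ⟨fun h => by simp [deg] at h, fun p h => ?_⟩
        have hw : deg w = p := by simpa [deg, List.countP_cons] using h
        refine Submodule.add_mem _ ?_ ?_
        · rcases p with _ | p
          · rw [ih.1 hw]; simp
          · have := Submodule.neg_mem _ (mul_homog h1 (ih.2 p hw))
            simpa [add_comm] using this
        · have := mul_homog h0 (word_mem_homog (k := k) w)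
          simpa [hw] using this
  | zero => simp
  | add x y _ _ hx hy => rw [map_add]; exact Submodule.add_mem _ hx hy
  | smul c x _ hx => rw [map_smul]; exact Submodule.smul_mem _ _ hx

/-- Applying an odd derivation to [v, w] gives [contr v, w] ± [v, contr w], with sign the parity of
v; compatibility with the shift is `contr_SΩ`. -/
theorem varRel_le_comap_contr : varRel k ℓ ≤ (varRel k ℓ).comap contr := by
  refine varRel_le_of_words _ _ (fun w => ?_) fun v w => ?_
  · rw [← SΩ_word, contr_SΩ]; exact SΩ_sub_mem_varRel _
  -- Contraction flips the parity. Giving `contr` of a degree-0 word the degree 1 keeps this sign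
  -- rule valid without a separate case.
  · have par : ∀ p : ℕ, (-1 : k) ^ (if p = 0 then 1 else p - 1) = -(-1) ^ p := by
      rintro (_ | p) <;> simp [pow_succ]
    have h1 : contr (word k v) * word k w - (-1 : k) ^ ((if deg v = 0 then 1 else deg v - 1) * deg w)
        • (word k w * contr (word k v)) ∈ varRel k ℓ := by
      rw [← neg_one_pow_mul_eq_smul]
      exact Submodule.mem_sup_right (Submodule.subset_span
        ⟨_, _, _, _, contr_homog (word_mem_homog v), word_mem_homog w, rfl⟩)
    have h2 : word k v * contr (word k w) - (-1 : k) ^ (deg v * (if deg w = 0 then 1 else deg w - 1))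
        • (contr (word k w) * word k v) ∈ varRel k ℓ := by
      rw [← neg_one_pow_mul_eq_smul]
      exact Submodule.mem_sup_right (Submodule.subset_span
        ⟨_, _, _, _, word_mem_homog v, contr_homog (word_mem_homog w), rfl⟩)
    have key : contr (word k (v ++ w)) - (-1 : k) ^ (deg v * deg w) • contr (word k (w ++ v)) =
        (contr (word k v) * word k w -
          (-1 : k) ^ ((if deg v = 0 then 1 else deg v - 1) * deg w) •
            (word k w * contr (word k v))) +
        (-1 : k) ^ deg v • (word k v * contr (word k w) -
          (-1 : k) ^ (deg v * (if deg w = 0 then 1 else deg w - 1)) •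
            (contr (word k w) * word k v)) := by
      rw [word_append, word_append, contr_mul, contr_mul, parity_word, parity_word,
        pow_mul, pow_mul, par, mul_comm (deg v) (ite _ _ _), pow_mul, par]
      rcases Nat.even_or_odd (deg v) with hv | hv <;>
        rcases Nat.even_or_odd (deg w) with hw | hw <;>
        simp only [hv.neg_one_pow, hw.neg_one_pow, one_pow, neg_neg, one_smul, neg_smul,
          neg_mul] <;>
        abel
    rw [key]
    exact Submodule.add_mem _ h1 (Submodule.smul_mem _ _ h2)

/-- Cartan's formula: the anticommutator of `d` and `contr` is the number operator. -/
theorem cartan_word (w : List (Letter ℓ)) :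
    contr (d (word k w)) + d (contr (word k w)) = (w.length : k) • word k w := by
  induction w with
  | nil => simp [d_one, contr_one]
  | cons x w ih =>
    have h1 : contr (d (FreeAlgebra.ι k x)) + d (contr (FreeAlgebra.ι k x)) =
        FreeAlgebra.ι k x := by
      rcases x with x | x <;> simp [contr_ι_inl, contr_ι_inr, d_ι_inl, d_ι_inr]
    -- The anticommutator of two odd derivations is an even derivation, so its value on a word is
    -- determined by its values on letters.
    have h2 : ∀ a b : DeRham k ℓ, contr (d (a * b)) + d (contr (a * b)) =
        a * (contr (d b) + d (contr b)) + (contr (d a) + d (contr a)) * b := by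
      intro a b
      simp only [d_mul, contr_mul, map_add, parity_parity, parity_d, parity_contr, neg_mul]
      noncomm_ring
    rw [word_cons, h2, ih, h1, List.length_cons, mul_smul_comm]
    push_cast
    rw [add_smul, one_smul]

/-! ### The Poincaré lemma -/

section PoincareLemma

/-- Division of every non-empty word by its length. -/
def lenInv : DeRham k ℓ →ₗ[k] DeRham k ℓ :=
  wordLift fun w => (w.length : k)⁻¹ • word k w

theorem lenInv_word (w : List (Letter ℓ)) :
    lenInv (word k w) = (w.length : k)⁻¹ • word k w := wordLift_word _ _

/-- The projection on the constants. -/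
def constPart : DeRham k ℓ →ₐ[k] DeRham k ℓ :=
  (Algebra.ofId k (DeRham k ℓ)).comp FreeAlgebra.algebraMapInv

theorem constPart_ι (x : Letter ℓ) : constPart (FreeAlgebra.ι k x) = 0 := by
  simp [constPart, FreeAlgebra.algebraMapInv]

theorem constPart_word_cons (x : Letter ℓ) (w : List (Letter ℓ)) :
    constPart (word k (x :: w)) = 0 := by
  rw [word_cons, map_mul, constPart_ι, zero_mul]

theorem constPart_d (a : DeRham k ℓ) : constPart (d a) = 0 := by
  induction a using word_induction with
  | hw w =>
    rcases w with _ | ⟨x, w⟩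
    · simp [d_one]
    · rw [word_cons, d_mul, map_add, map_mul, map_mul]
      rcases x with x | x
      · simp [parity, uΩ, d_ι_inl, constPart_ι]
      · simp [parity, du, d_ι_inr, constPart_ι]
  | h0 => simp
  | ha a b ha hb => simp [ha, hb]
  | hs c a ha => simp [ha]

theorem constPart_homog_succ {p : ℕ} {a : DeRham k ℓ} (ha : a ∈ homog k ℓ (p + 1)) :
    constPart a = 0 := by
  induction ha using Submodule.span_induction with
  | mem x hx =>
    obtain ⟨w, hw, rfl⟩ := hx
    rcases w with _ | ⟨x, w⟩
    · simp at hw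
    · exact constPart_word_cons x w
  | zero => simp
  | add x y _ _ hx hy => rw [map_add, hx, hy, add_zero]
  | smul c x _ hx => rw [map_smul, hx, smul_zero]

theorem lenInv_homog {p : ℕ} {a : DeRham k ℓ} (ha : a ∈ homog k ℓ p) :
    lenInv a ∈ homog k ℓ p := by
  induction ha using Submodule.span_induction with
  | mem x hx =>
    obtain ⟨w, rfl, rfl⟩ := hx
    change lenInv (word k w) ∈ _
    rw [lenInv_word]
    exact Submodule.smul_mem _ _ (word_mem_homog w)
  | zero => simp
  | add x y _ _ hx hy => rw [map_add]; exact Submodule.add_mem _ hx hy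
  | smul c x _ hx => rw [map_smul]; exact Submodule.smul_mem _ _ hx

theorem varRel_le_comap_lenInv : varRel k ℓ ≤ (varRel k ℓ).comap lenInv := by
  refine varRel_le_of_words _ _ (fun w => ?_) fun v w => ?_
  · rw [lenInv_word, lenInv_word, List.length_map, ← smul_sub, ← SΩ_word]
    exact Submodule.smul_mem _ _ (SΩ_sub_mem_varRel _)
  · rw [lenInv_word, lenInv_word, smul_comm, List.length_append, List.length_append,
      add_comm w.length, ← smul_sub, ← neg_one_pow_mul_eq_smul]
    exact Submodule.smul_mem _ _ (word_sub_mem_varRel v w)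

variable [CharZero k]

/-- The number operator composed with its partial inverse is the identity away from the constants.
-/
theorem cartan_lenInv (a : DeRham k ℓ) :
    contr (d (lenInv a)) + d (contr (lenInv a)) = a - constPart a := by
  induction a using word_induction with
  | hw w =>
    rw [lenInv_word]
    simp only [map_smul]
    rw [← smul_add, cartan_word]
    -- For the empty word the convention 0⁻¹ = 0 makes the left side vanish, which matches 1 −
    -- `constPart` 1 = 0.
    rcases w with _ | ⟨x, w⟩
    · simp
    · rw [constPart_word_cons, sub_zero, smul_smul, inv_mul_cancel₀, one_smul]
      simpa using Nat.cast_add_one_ne_zero _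
  | h0 => simp
  | ha a b ha hb =>
    simp only [map_add]
    rw [add_add_add_comm, ha, hb]; abel
  | hs c a ha =>
    simp only [map_smul]
    rw [← smul_add, ha, smul_sub]

theorem lenInv_cartan (a : DeRham k ℓ) :
    lenInv (contr (d a) + d (contr a)) = a - constPart a := by
  induction a using word_induction with
  | hw w =>
    rw [cartan_word, map_smul, lenInv_word]
    rcases w with _ | ⟨x, w⟩
    · simp
    · rw [constPart_word_cons, sub_zero, smul_smul, mul_inv_cancel₀, one_smul]
      simpa using Nat.cast_add_one_ne_zero _
  | h0 => simp
  | ha a b ha hb =>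
    simp only [map_add] at ha hb ⊢
    rw [add_add_add_comm, ha, hb]; abel
  | hs c a ha =>
    simp only [map_smul]
    rw [← smul_add, map_smul, ha, smul_sub]

/-- The differential preserves length. This is extracted from Cartan's formula: since d² = 0, `d`
commutes with the number operator. -/
theorem lenInv_d (a : DeRham k ℓ) : lenInv (d a) = d (lenInv a) := by
  induction a using word_induction with
  | hw w =>
    -- As d² = 0 and `d` has no constant term, this says that `lenInv` of d(contr(d w)) is d w,
    -- while `h2` identifies that argument as the length times d w.
    have h1 := lenInv_cartan (d (word k w))
    have h2 : d (contr (d (word k w))) = (w.length : k) • d (word k w) := by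
      rw [← map_smul, ← cartan_word, map_add, d_d, add_zero]
    rw [constPart_d, d_d, map_zero, zero_add, sub_zero, h2, map_smul] at h1
    rw [lenInv_word, map_smul]
    rcases w with _ | ⟨x, w⟩
    · simp [d_one]
    · rw [← h1, smul_smul, inv_mul_cancel₀, one_smul, h1]
      simpa using Nat.cast_add_one_ne_zero _
  | h0 => simp
  | ha a b ha hb => simp only [map_add, ha, hb]
  | hs c a ha => simp only [map_smul, ha]

/-- The Poincaré lemma for the variational complex. -/
theorem sub_d_contr_mem_varRel {a : DeRham k ℓ} (ha : d a ∈ varRel k ℓ) :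
    a - constPart a - d (contr (lenInv a)) ∈ varRel k ℓ := by
  -- The remainder is contr(d(lenInv a)) = contr(lenInv(d a)), and both operators preserve `varRel`.
  rw [← cartan_lenInv, add_sub_cancel_right, ← lenInv_d]
  exact varRel_le_comap_contr (varRel_le_comap_lenInv ha)

end PoincareLemma

/-! ### Cyclic functionals -/

open Classical in
variable (k) in
/-- The signed contribution of the rotation `a ++ b ↦ b ++ a` to `cycFun t`. -/
def rotTerm (t a b : List (Letter ℓ)) : k :=
  (-1) ^ (deg a * deg b) * if ∃ n, (b ++ a).map (shiftLetter n) = t then 1 else 0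

variable (k) in
/-- The signed number of the rotations of `x ++ y` starting inside `x` which agree with `t` up to
a shift. -/
def rotSum (t x y : List (Letter ℓ)) : k :=
  ∑ r ∈ Finset.range x.length, rotTerm k t (x.take r) (x.drop r ++ y)

variable (k) in
/-- The functional counting with signs the rotations of a word which agree with `t` up to a
shift. -/
def cycFun (t : List (Letter ℓ)) : DeRham k ℓ →ₗ[k] k := wordLift fun w => rotSum k t w []

theorem deg_append (v w : List (Letter ℓ)) : deg (v ++ w) = deg v + deg w := List.countP_append

/-- A rotation of x ++ y starts inside x or inside y. The latter are the rotations of y ++ x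
starting inside y, up to the sign for exchanging x and y. -/
theorem cycFun_append (t x y : List (Letter ℓ)) :
    cycFun k t (word k (x ++ y)) =
      rotSum k t x y + (-1) ^ (deg x * deg y) * rotSum k t y x := by
  rw [cycFun, wordLift_word, rotSum, List.length_append, Finset.sum_range_add]
  congr 1
  · refine Finset.sum_congr rfl fun r hr => ?_
    have hr : r ≤ x.length := (Finset.mem_range.1 hr).le
    rw [List.append_nil, List.take_append_of_le_length hr, List.drop_append_of_le_length hr]
  · rw [rotSum, Finset.mul_sum]
    refine Finset.sum_congr rfl fun r _ => ?_
    rw [List.append_nil, List.take_length_add_append, List.drop_length_add_append, rotTerm, rotTerm,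
      ← mul_assoc, ← List.append_assoc]
    congr 1
    have h : deg y = deg (y.take r) + deg (y.drop r) := by rw [← deg_append, List.take_append_drop]
    rw [deg_append, deg_append, h, ← pow_add]
    generalize deg x = p
    generalize deg (y.take r) = q
    generalize deg (y.drop r) = s
    -- Exchanging x with y and then rotating inside y carries the prefix of y past x twice; these
    -- two signs cancel.
    have e : p * (q + s) + q * (s + p) = (p + q) * s + 2 * (p * q) := by ring
    rw [e, pow_add, pow_mul _ 2]
    simp

theorem exists_shift_iff (t w : List (Letter ℓ)) (m : ℤ) :
    (∃ n, (w.map (shiftLetter m)).map (shiftLetter n) = t) ↔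
      ∃ n, w.map (shiftLetter n) = t := by
  simp only [map_shiftLetter_map]
  exact ⟨fun ⟨n, h⟩ => ⟨_, h⟩, fun ⟨n, h⟩ => ⟨n - m, by simpa using h⟩⟩

/-- Matching up to a shift is shift invariant. Exchanging v and w only swaps the two summands of
`cycFun_append`, up to the Koszul sign, whose square is 1. -/
theorem cycFun_eq_zero (t : List (Letter ℓ)) {a : DeRham k ℓ} (ha : a ∈ varRel k ℓ) :
    cycFun k t a = 0 := by
  have h : varRel k ℓ ≤ (⊥ : Submodule k k).comap (cycFun k t) := by
    refine varRel_le_of_words _ _ (fun w => ?_) fun v w => ?_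
    · rw [Submodule.mem_bot, sub_eq_zero, cycFun, wordLift_word, wordLift_word, rotSum, rotSum,
        List.length_map]
      refine Finset.sum_congr rfl fun r _ => ?_
      rw [rotTerm, rotTerm, List.append_nil, List.append_nil, ← List.map_take, ← List.map_drop,
        deg_map_shiftLetter, deg_map_shiftLetter, ← List.map_append]
      congr 1
      classical exact if_congr (exists_shift_iff _ _ _) rfl rfl
    · rw [Submodule.mem_bot, cycFun_append, cycFun_append, smul_eq_mul, mul_comm (deg w)]
      rcases neg_one_pow_eq_or k (deg v * deg w) with h | h <;> rw [h] <;> ring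
  exact (Submodule.mem_bot k).1 (h ha)

open Classical in
-- Any rotation starting after the first letter of this block ends in a letter u, whereas the target
-- ends in a δu. Only the rotation by 0 can match.
theorem rotSum_inl_append_inr (t y : List (Letter ℓ)) (p q : Fin ℓ × ℤ) (a : List (Fin ℓ × ℤ)) :
    rotSum k (t ++ [Sum.inr p]) (a.map Sum.inl ++ [Sum.inr q]) y =
      if ∃ n, (a.map Sum.inl ++ Sum.inr q :: y).map (shiftLetter n) = t ++ [Sum.inr p]
        then 1 else 0 := by
  rw [rotSum, List.length_append, List.length_map, List.length_singleton, Finset.sum_range_succ',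
    Finset.sum_eq_zero, zero_add]
  · simp [rotTerm]
  · intro r hr
    have hr : r < a.length := Finset.mem_range.1 hr
    rw [rotTerm, if_neg, mul_zero]
    rintro ⟨n, hn⟩
    rw [List.take_append_of_le_length (by simpa using hr), ← List.map_take,
      ← List.take_append_getElem hr] at hn
    simp only [List.map_append, List.map_cons, List.map_nil, ← List.append_assoc] at hn
    simpa using (List.append_inj' hn rfl).2

theorem map_inl_append_inr_inj {a a' : List (Fin ℓ × ℤ)} {x x' : Fin ℓ × ℤ}
    {r r' : List (Letter ℓ)} :
    a.map Sum.inl ++ Sum.inr x :: r = a'.map Sum.inl ++ Sum.inr x' :: r' ↔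
      a = a' ∧ x = x' ∧ r = r' := by
  induction a generalizing a' with
  | nil => cases a' <;> simp
  | cons y a ih => cases a' <;> simp [ih, and_assoc]

/-- Translation of the letters of `R`. -/
def shiftIndex (n : ℤ) (p : Fin ℓ × ℤ) : Fin ℓ × ℤ := (p.1, p.2 + n)

theorem map_shiftLetter_map_inl (n : ℤ) (a : List (Fin ℓ × ℤ)) :
    (a.map Sum.inl).map (shiftLetter n) = (a.map (shiftIndex n)).map Sum.inl := by
  simp [shiftIndex]

theorem shiftIndex_zero : (shiftIndex 0 : Fin ℓ × ℤ → Fin ℓ × ℤ) = id := by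
  funext p; simp [shiftIndex]

open Classical in
theorem cycFun_oneWord (a a₀ : List (Fin ℓ × ℤ)) (i i₀ : Fin ℓ) :
    cycFun k (a₀.map Sum.inl ++ [Sum.inr (i₀, 0)]) (word k (a.map Sum.inl ++ [Sum.inr (i, 0)])) =
      if a = a₀ ∧ i = i₀ then 1 else 0 := by
  rw [cycFun, wordLift_word, rotSum_inl_append_inr]
  refine if_congr ?_ rfl rfl
  simp only [List.map_append, List.map_cons, List.map_nil, map_shiftLetter_map_inl,
    shiftLetter_inr, map_inl_append_inr_inj, Prod.mk.injEq, and_true]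
  constructor
  · rintro ⟨n, h, h1, h2⟩
    obtain rfl : n = 0 := by simpa using h2
    exact ⟨by simpa [shiftIndex_zero] using h, h1⟩
  · rintro ⟨rfl, rfl⟩
    exact ⟨0, by simp [shiftIndex_zero], rfl, by simp⟩

open Classical in
-- Two rotations end in a δu. The last letter must become δu with index 0, so the shift is 0 for the
-- word itself and −n for the other rotation, which carries a minus sign because two odd blocks are
-- exchanged.
theorem cycFun_twoWord (a b a₀ b₀ : List (Fin ℓ × ℤ)) (i j i₀ j₀ : Fin ℓ) (n n₀ : ℤ) :
    cycFun k (a₀.map Sum.inl ++ Sum.inr (i₀, n₀) :: (b₀.map Sum.inl ++ [Sum.inr (j₀, 0)]))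
      (word k (a.map Sum.inl ++ Sum.inr (i, n) :: (b.map Sum.inl ++ [Sum.inr (j, 0)]))) =
      (if i = i₀ ∧ j = j₀ ∧ n = n₀ ∧ a = a₀ ∧ b = b₀ then 1 else 0) -
      (if j = i₀ ∧ i = j₀ ∧ -n = n₀ ∧ b.map (shiftIndex (-n)) = a₀ ∧
        a.map (shiftIndex (-n)) = b₀ then 1 else 0) := by
  have e1 : a₀.map Sum.inl ++ Sum.inr (i₀, n₀) :: (b₀.map Sum.inl ++ [Sum.inr (j₀, 0)]) =
      (a₀.map Sum.inl ++ Sum.inr (i₀, n₀) :: b₀.map Sum.inl) ++ [Sum.inr (j₀, 0)] := by simp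
  have e2 : a.map Sum.inl ++ Sum.inr (i, n) :: (b.map Sum.inl ++ [Sum.inr (j, 0)]) =
      (a.map Sum.inl ++ [Sum.inr (i, n)]) ++ (b.map Sum.inl ++ [Sum.inr (j, 0)]) := by simp
  have hd : ∀ (c : List (Fin ℓ × ℤ)) (x : Fin ℓ × ℤ),
      deg (c.map Sum.inl ++ [Sum.inr x] : List (Letter ℓ)) = 1 := by
    intro c x
    rw [deg_append]
    simp [deg, List.countP_map, Function.comp_def]
  rw [e2, cycFun_append, hd, hd, e1, rotSum_inl_append_inr, rotSum_inl_append_inr, ← e1, sub_eq_add_neg]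
  simp only [List.map_append, List.map_cons, List.map_nil, map_shiftLetter_map_inl,
    shiftLetter_inr, map_inl_append_inr_inj, Prod.mk.injEq, and_true]
  congr 1
  · refine if_congr ?_ rfl rfl
    constructor
    · rintro ⟨m, h, ⟨h1, h2⟩, h3, h4, h5⟩
      obtain rfl : m = 0 := by simpa using h5
      simp only [shiftIndex_zero, List.map_id, add_zero] at h h2 h3
      exact ⟨h1, h4, h2, h, h3⟩
    · rintro ⟨rfl, rfl, rfl, rfl, rfl⟩
      exact ⟨0, by simp [shiftIndex_zero]⟩
  · simp only [mul_one, pow_one, neg_mul, one_mul]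
    congr 1
    refine if_congr ?_ rfl rfl
    constructor
    · rintro ⟨m, h, ⟨h1, h2⟩, h3, h4, h5⟩
      obtain rfl : m = -n := by omega
      exact ⟨h1, h4, by omega, h, h3⟩
    · rintro ⟨rfl, rfl, rfl, rfl, rfl⟩
      exact ⟨-n, by simp⟩

/-! ### Words in `R` and in `R ⊗ R` -/

theorem incl_word (a : List (Fin ℓ × ℤ)) : incl (word k a) = word k (a.map Sum.inl) := by
  induction a with
  | nil => simp
  | cons x a ih => rw [word_cons, map_mul, ih, List.map_cons, word_cons]; simp [incl, uΩ]

theorem S_zpow_apply (n : ℤ) (f : DiffPoly k ℓ) : (S ^ n) f = shiftHom n f := by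
  have hadd : ∀ (m n : ℤ) (f : DiffPoly k ℓ), shiftHom m (shiftHom n f) = shiftHom (n + m) f :=
    fun m n f => DFunLike.congr_fun (f := (shiftHom m).comp (shiftHom n)) (g := shiftHom (n + m))
      (by ext p; simp [shiftHom, u, add_assoc]) f
  have h1 : ∀ f : DiffPoly k ℓ, S f = shiftHom 1 f := fun f => rfl
  have h2 : ∀ f : DiffPoly k ℓ, S⁻¹ f = shiftHom (-1) f := fun f => rfl
  induction n generalizing f with
  | zero =>
    have : (shiftHom 0 : DiffPoly k ℓ →ₐ[k] _) = AlgHom.id k _ := by ext p; simp [shiftHom, u]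
    simp [this]
  | succ n ih => rw [zpow_add_one, AlgEquiv.mul_apply, h1, ih, hadd, add_comm]
  | pred n ih => rw [zpow_sub_one, AlgEquiv.mul_apply, h2, ih, hadd, add_comm]; rfl

theorem shiftHom_word (n : ℤ) (a : List (Fin ℓ × ℤ)) :
    shiftHom n (word k a) = word k (a.map (shiftIndex n)) := by
  induction a with
  | nil => simp
  | cons x a ih =>
    rw [word_cons, map_mul, ih, List.map_cons, word_cons]; simp [shiftHom, u, shiftIndex]

theorem Spow2_tmul (n : ℤ) (a b : DiffPoly k ℓ) :
    Spow2 n (a ⊗ₜ[k] b) = shiftHom n a ⊗ₜ[k] shiftHom n b := by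
  simp [Spow2, S_zpow_apply]

theorem flip2_tmul (a b : DiffPoly k ℓ) : flip2 (a ⊗ₜ[k] b) = b ⊗ₜ[k] a := rfl

theorem tensor_word_hom_ext {M : Type*} [AddCommGroup M] [Module k M]
    {f g : DiffPoly k ℓ ⊗[k] DiffPoly k ℓ →ₗ[k] M}
    (h : ∀ a b, f (word k a ⊗ₜ[k] word k b) = g (word k a ⊗ₜ[k] word k b)) : f = g :=
  TensorProduct.ext (word_hom_ext fun a => word_hom_ext fun b => h a b)

/-- The coefficient of a pair of words in an element of `R ⊗ R`. -/
def tcoord (a b : List (Fin ℓ × ℤ)) : DiffPoly k ℓ ⊗[k] DiffPoly k ℓ →ₗ[k] k :=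
  ((wordBasis k _).tensorProduct (wordBasis k _)).coord (a, b)

theorem tcoord_ext {x y : DiffPoly k ℓ ⊗[k] DiffPoly k ℓ}
    (h : ∀ a b, tcoord a b x = tcoord a b y) : x = y :=
  ((wordBasis k _).tensorProduct (wordBasis k _)).ext_elem fun p => h p.1 p.2

open Classical in
theorem tcoord_word (a b a₀ b₀ : List (Fin ℓ × ℤ)) :
    tcoord a₀ b₀ (word k a ⊗ₜ[k] word k b) = if a = a₀ ∧ b = b₀ then 1 else 0 := by
  rw [← wordBasis_apply, ← wordBasis_apply, ← Module.Basis.tensorProduct_apply, tcoord,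
    Module.Basis.coord_apply, Module.Basis.repr_self, Finsupp.single_apply]
  simp

theorem sandwich_word (p : Fin ℓ × ℤ) (a b : List (Fin ℓ × ℤ)) :
    sandwich p (word k a ⊗ₜ[k] word k b) = word k (a.map Sum.inl ++ Sum.inr p :: b.map Sum.inl) := by
  rw [sandwich_tmul, incl_word, incl_word, word_append, word_cons, mul_assoc]; rfl

theorem word_mul_du (w : List (Letter ℓ)) (p : Fin ℓ × ℤ) :
    word k w * du p = word k (w ++ [Sum.inr p]) := by
  rw [word_append, word_singleton]; rfl

/-! ### Recovering coefficients of forms from cyclic functionals -/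

theorem cycFun_incl_mul_du (a₀ : List (Fin ℓ × ℤ)) (i i₀ : Fin ℓ) (f : DiffPoly k ℓ) :
    cycFun k (a₀.map Sum.inl ++ [Sum.inr (i₀, 0)]) (incl f * du (i, 0)) =
      if i = i₀ then (wordBasis k _).coord a₀ f else 0 := by
  classical
  induction f using word_induction with
  | hw a =>
    rw [incl_word, word_mul_du, cycFun_oneWord, ← wordBasis_apply, Module.Basis.coord_apply,
      Module.Basis.repr_self, Finsupp.single_apply]
    split_ifs <;> simp_all
  | h0 => simp
  | ha a b ha hb => rw [map_add, add_mul, map_add, ha, hb, map_add]; split_ifs <;> simp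
  | hs c a ha => rw [map_smul, smul_mul_assoc, map_smul, ha, map_smul]; split_ifs <;> simp

/-- Every coefficient of every component F_i is the value of some cyclic functional, hence depends
only on the class. -/
theorem oneForm_injective : Function.Injective (oneForm (k := k) (ℓ := ℓ)) := by
  intro F G h
  have h := (Submodule.Quotient.eq _).1 h
  funext i
  refine (wordBasis k _).ext_elem fun a => ?_
  have := cycFun_eq_zero (a.map Sum.inl ++ [Sum.inr (i, 0)]) h
  simpa [map_sum, cycFun_incl_mul_du, sub_eq_zero] using this

theorem cycFun_sandwich_mul_du (a₀ b₀ : List (Fin ℓ × ℤ)) (i j i₀ j₀ : Fin ℓ) (n n₀ : ℤ)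
    (c : DiffPoly k ℓ ⊗[k] DiffPoly k ℓ) :
    cycFun k (a₀.map Sum.inl ++ Sum.inr (i₀, n₀) :: (b₀.map Sum.inl ++ [Sum.inr (j₀, 0)]))
      (sandwich (i, n) c * du (j, 0)) =
      (if i = i₀ ∧ j = j₀ ∧ n = n₀ then tcoord a₀ b₀ c else 0) -
      (if j = i₀ ∧ i = j₀ ∧ -n = n₀ then tcoord a₀ b₀ (Spow2 (-n) (flip2 c)) else 0) := by
  classical
  set t := a₀.map Sum.inl ++ Sum.inr (i₀, n₀) :: (b₀.map Sum.inl ++ [Sum.inr (j₀, 0)]) with ht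
  refine DFunLike.congr_fun (f := (cycFun k t) ∘ₗ LinearMap.mulRight k (du (j, 0)) ∘ₗ sandwich (i, n))
    (g := (if i = i₀ ∧ j = j₀ ∧ n = n₀ then (1 : k) else 0) • tcoord a₀ b₀ -
      (if j = i₀ ∧ i = j₀ ∧ -n = n₀ then (1 : k) else 0) •
        (tcoord a₀ b₀ ∘ₗ Spow2 (-n) ∘ₗ flip2)) ?_ c |>.trans ?_
  · refine tensor_word_hom_ext fun a b => ?_
    simp only [LinearMap.comp_apply, LinearMap.mulRight_apply, LinearMap.sub_apply,
      LinearMap.smul_apply, sandwich_word, word_mul_du, flip2_tmul, Spow2_tmul, shiftHom_word,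
      tcoord_word, List.append_assoc, List.cons_append, ht, cycFun_twoWord, smul_eq_mul,
      ← ite_and, mul_ite, mul_one, mul_zero, and_assoc]
    congr 1 <;> exact if_congr (by tauto) rfl rfl
  · simp only [LinearMap.sub_apply, LinearMap.smul_apply, LinearMap.comp_apply, smul_eq_mul,
      ite_mul, one_mul, zero_mul]

/-- The element of the de Rham algebra representing `twoForm A`. -/
def twoFormRep (A : Array2 k ℓ) : DeRham k ℓ :=
  ∑ i, ∑ j, (A i j).coeff.sum fun n a => sandwich (i, n) a * du (j, 0)

theorem adj_coeff (A : LaurentPolynomial (DiffPoly k ℓ ⊗[k] DiffPoly k ℓ)) (n : ℤ) :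
    (adj A).coeff n = Spow2 n (flip2 (A.coeff (-n))) := by
  rw [adj, AddMonoidAlgebra.coeff_finsuppSum, Finsupp.sum_apply,
    Finsupp.sum_eq_single (-n)]
  · rw [AddMonoidAlgebra.coeff_single, neg_neg, Finsupp.single_eq_same]
  · intro m _ hm
    rw [AddMonoidAlgebra.coeff_single, Finsupp.single_eq_of_ne]
    omega
  · simp

theorem cycFun_twoFormRep (a₀ b₀ : List (Fin ℓ × ℤ)) (i₀ j₀ : Fin ℓ) (n₀ : ℤ) (A : Array2 k ℓ) :
    cycFun k (a₀.map Sum.inl ++ Sum.inr (i₀, n₀) :: (b₀.map Sum.inl ++ [Sum.inr (j₀, 0)]))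
      (twoFormRep A) =
      tcoord a₀ b₀ ((A i₀ j₀).coeff n₀ - (adj (A j₀ i₀)).coeff n₀) := by
  classical
  simp only [twoFormRep, map_sum, map_finsuppSum, cycFun_sandwich_mul_du, Finsupp.sum_sub,
    Finset.sum_sub_distrib, map_sub, adj_coeff]
  congr 1
  · rw [Finset.sum_eq_single i₀ _ (by simp), Finset.sum_eq_single j₀ _ (by simp),
      Finsupp.sum_eq_single n₀]
    · simp
    · intro m _ hm; simp [hm]
    · simp
    · intro j _ hj; simp [hj, Finsupp.sum]
    · intro i _ hi; simp [hi, Finsupp.sum]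
  · rw [Finset.sum_eq_single j₀ _ (by simp), Finset.sum_eq_single i₀ _ (by simp),
      Finsupp.sum_eq_single (-n₀)]
    · simp
    · intro m _ hm; rw [if_neg]; rintro ⟨-, -, h⟩; omega
    · simp
    · intro j _ hj; simp [hj, Finsupp.sum]
    · intro i _ hi; simp [hi, Finsupp.sum]

/-- Cyclic functionals see only this skewadjoint combination. No more can be recovered, since A and
−adj(Aᵗ) define the same form (`twoForm_adj`). -/
theorem sub_adj_eq_of_twoForm_eq {A B : Array2 k ℓ} (h : twoForm A = twoForm B) (i j : Fin ℓ) :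
    A i j - adj (A j i) = B i j - adj (B j i) := by
  have h : twoFormRep A - twoFormRep B ∈ varRel k ℓ := (Submodule.Quotient.eq _).1 h
  ext n
  refine tcoord_ext fun a b => ?_
  have := cycFun_eq_zero
    (a.map Sum.inl ++ Sum.inr (i, n) :: (b.map Sum.inl ++ [Sum.inr (j, 0)])) h
  rw [map_sub, cycFun_twoFormRep, cycFun_twoFormRep, sub_eq_zero] at this
  simpa using this

/-! ### Normal forms of forms of low degree -/

theorem mkQ_word_shift (n : ℤ) (w : List (Letter ℓ)) :
    (varRel k ℓ).mkQ (word k (w.map (shiftLetter n))) = (varRel k ℓ).mkQ (word k w) := by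
  have h1 : ∀ w : List (Letter ℓ), (varRel k ℓ).mkQ (word k (w.map (shiftLetter 1))) =
      (varRel k ℓ).mkQ (word k w) := fun w => by
    rw [← SΩ_word]; exact (Submodule.Quotient.eq _).2 (SΩ_sub_mem_varRel _)
  induction n generalizing w with
  | zero => rw [shiftLetter_zero, List.map_id]
  | succ n ih => rw [← map_shiftLetter_map, h1, ih]
  | pred n ih => rw [← h1, map_shiftLetter_map, sub_add_cancel, ih]

theorem mkQ_word_append (v w : List (Letter ℓ)) :
    (varRel k ℓ).mkQ (word k (v ++ w)) =
      (-1 : k) ^ (deg v * deg w) • (varRel k ℓ).mkQ (word k (w ++ v)) := by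
  rw [← map_smul, ← neg_one_pow_mul_eq_smul]
  exact (Submodule.Quotient.eq _).2 (word_sub_mem_varRel v w)

theorem deg_map_inl (a : List (Fin ℓ × ℤ)) : deg (a.map Sum.inl : List (Letter ℓ)) = 0 := by
  simp [deg]

theorem exists_map_inl_of_deg {w : List (Letter ℓ)} (h : deg w = 0) :
    ∃ a : List (Fin ℓ × ℤ), w = a.map Sum.inl := by
  induction w with
  | nil => exact ⟨[], rfl⟩
  | cons x w ih =>
    rcases x with x | x
    · obtain ⟨a, rfl⟩ := ih (by simpa [deg] using h)
      exact ⟨x :: a, rfl⟩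
    · simp [deg] at h

theorem exists_split_of_deg {w : List (Letter ℓ)} (h : deg w = 1) :
    ∃ (a b : List (Fin ℓ × ℤ)) (p : Fin ℓ × ℤ), w = a.map Sum.inl ++ Sum.inr p :: b.map Sum.inl := by
  induction w with
  | nil => simp [deg] at h
  | cons x w ih =>
    rcases x with x | x
    · obtain ⟨a, b, p, rfl⟩ := ih (by simpa [deg] using h)
      exact ⟨x :: a, b, p, rfl⟩
    · obtain ⟨b, rfl⟩ := exists_map_inl_of_deg (w := w) (by simpa [deg, List.countP_cons] using h)
      exact ⟨[], b, x, rfl⟩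

theorem exists_incl_of_mem_homog {a : DeRham k ℓ} (ha : a ∈ homog k ℓ 0) :
    ∃ f : DiffPoly k ℓ, incl f = a := by
  change a ∈ LinearMap.range (incl : DiffPoly k ℓ →ₐ[k] DeRham k ℓ).toLinearMap
  refine Submodule.span_le.2 ?_ ha
  rintro _ ⟨w, hw, rfl⟩
  obtain ⟨v, rfl⟩ := exists_map_inl_of_deg hw
  exact ⟨word k v, incl_word v⟩

theorem incl_mem_homog (f : DiffPoly k ℓ) : incl f ∈ homog k ℓ 0 := by
  induction f using word_induction with
  | hw w => rw [incl_word, ← deg_map_inl w]; exact word_mem_homog _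
  | h0 => simp
  | ha a b ha hb => rw [map_add]; exact Submodule.add_mem _ ha hb
  | hs c a ha => rw [map_smul]; exact Submodule.smul_mem _ _ ha

theorem du_mem_homog (p : Fin ℓ × ℤ) : (du p : DeRham k ℓ) ∈ homog k ℓ 1 :=
  Submodule.subset_span ⟨[Sum.inr p], by simp, by simp [du]⟩

theorem sandwich_mem_homog (p : Fin ℓ × ℤ) (c : DiffPoly k ℓ ⊗[k] DiffPoly k ℓ) :
    sandwich p c ∈ homog k ℓ 1 := by
  induction c with
  | zero => simp
  | tmul a b =>
    rw [sandwich_tmul]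
    have h := mul_homog (mul_homog (incl_mem_homog a) (du_mem_homog p)) (incl_mem_homog b)
    rwa [zero_add, add_zero] at h
  | add x y hx hy => rw [map_add]; exact Submodule.add_mem _ hx hy

/-- The `1`-form `f δu_i`. -/
def oneFormSingle (i : Fin ℓ) : DiffPoly k ℓ →ₗ[k] VarComplex k ℓ :=
  (varRel k ℓ).mkQ ∘ₗ LinearMap.mulRight k (du (i, 0)) ∘ₗ incl.toLinearMap

theorem oneForm_eq_sum (F : Fin ℓ → DiffPoly k ℓ) : oneForm F = ∑ i, oneFormSingle i (F i) := by
  simp [oneForm, oneFormSingle]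

theorem oneForm_add (F G : Fin ℓ → DiffPoly k ℓ) : oneForm (F + G) = oneForm F + oneForm G := by
  simp [oneForm_eq_sum, Finset.sum_add_distrib]

theorem oneForm_smul (c : k) (F : Fin ℓ → DiffPoly k ℓ) : oneForm (c • F) = c • oneForm F := by
  simp [oneForm_eq_sum, Finset.smul_sum]

theorem oneForm_single (i : Fin ℓ) (f : DiffPoly k ℓ) :
    oneForm (Pi.single i f) = oneFormSingle i f := by
  rw [oneForm_eq_sum, Finset.sum_eq_single i]
  · simp
  · intro j _ hj; simp [hj]
  · simp

/-- The right factor has degree 0, so it rotates to the front without a sign; the shift by −n then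
turns δu_{i,n} into δu_{i,0}. This is the source of the flip and of S^{-n} in the variational
derivative. -/
theorem mkQ_sandwich (i : Fin ℓ) (n : ℤ) (c : DiffPoly k ℓ ⊗[k] DiffPoly k ℓ) :
    (varRel k ℓ).mkQ (sandwich (i, n) c) =
      oneFormSingle i (mult (flip2 (Spow2 (-n) c))) := by
  refine DFunLike.congr_fun (f := (varRel k ℓ).mkQ ∘ₗ sandwich (i, n))
    (g := oneFormSingle i ∘ₗ mult ∘ₗ flip2 ∘ₗ Spow2 (-n)) ?_ c
  refine tensor_word_hom_ext fun a b => ?_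
  simp only [LinearMap.comp_apply, sandwich_word, Spow2_tmul, shiftHom_word, flip2_tmul, mult,
    LinearMap.mul'_apply, oneFormSingle, LinearMap.mulRight_apply, AlgHom.toLinearMap_apply,
    incl_word, ← word_append, word_mul_du]
  have e : a.map Sum.inl ++ Sum.inr (i, n) :: b.map Sum.inl =
      (a.map Sum.inl ++ [Sum.inr (i, n)]) ++ b.map Sum.inl := by simp
  rw [e, mkQ_word_append, deg_map_inl, mul_zero, pow_zero, one_smul, ← mkQ_word_shift (-n)]
  simp only [List.map_append, List.map_cons, List.map_nil, map_shiftLetter_map_inl,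
    shiftLetter_inr, add_neg_cancel, List.append_assoc]

theorem exists_oneForm_of_mem_homog {a : DeRham k ℓ} (ha : a ∈ homog k ℓ 1) :
    ∃ F : Fin ℓ → DiffPoly k ℓ, oneForm F = (varRel k ℓ).mkQ a := by
  induction ha using Submodule.span_induction with
  | mem x hx =>
    obtain ⟨w, hw, rfl⟩ := hx
    obtain ⟨a, b, p, rfl⟩ := exists_split_of_deg hw
    refine ⟨Pi.single p.1 _, (oneForm_single _ _).trans (mkQ_sandwich p.1 p.2
      (word k a ⊗ₜ[k] word k b)).symm |>.trans ?_⟩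
    rw [sandwich_word]; rfl
  | zero => exact ⟨0, by simp [oneForm]⟩
  | add x y _ _ hx hy =>
    obtain ⟨F, hF⟩ := hx
    obtain ⟨G, hG⟩ := hy
    exact ⟨F + G, by rw [oneForm_add, hF, hG, map_add]⟩
  | smul c x _ hx =>
    obtain ⟨F, hF⟩ := hx
    exact ⟨c • F, by rw [oneForm_smul, hF, map_smul]⟩

/-! ### The differential in low degrees -/

theorem pd_finite_index (i : Fin ℓ) (f : DiffPoly k ℓ) : {n : ℤ | pd (i, n) f ≠ 0}.Finite :=
  (pd_finite f).preimage (f := fun n : ℤ => (i, n)) fun _ _ _ _ h => (Prod.mk.inj h).2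

/-- Supplies the finiteness needed to move additive maps through the sums over n. -/
theorem hasFiniteSupport_pd {M : Type*} [AddCommGroup M] (i : Fin ℓ) (f : DiffPoly k ℓ)
    (g : ℤ → DiffPoly k ℓ ⊗[k] DiffPoly k ℓ → M) (hg : ∀ n, g n 0 = 0) :
    Function.HasFiniteSupport fun n : ℤ => g n (pd (i, n) f) :=
  (pd_finite_index i f).subset fun n hn h => hn (by simp [h, hg])

theorem d_incl_eq_sum (f : DiffPoly k ℓ) :
    d (incl f) = ∑ i, ∑ᶠ n : ℤ, sandwich (i, n) (pd (i, n) f) := by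
  rw [d_incl, finsum_curry _ ((pd_finite f).subset fun p hp h => hp (by simp [h])),
    finsum_eq_sum_of_fintype]

theorem dVar_mkQ (a : DeRham k ℓ) : dVar ((varRel k ℓ).mkQ a) = (varRel k ℓ).mkQ (d a) := rfl

theorem dVar_mkQ_eq_zero {a : DeRham k ℓ} : dVar ((varRel k ℓ).mkQ a) = 0 ↔ d a ∈ varRel k ℓ := by
  rw [dVar_mkQ, Submodule.mkQ_apply, Submodule.Quotient.mk_eq_zero]

theorem dVar_zeroForm (f : DiffPoly k ℓ) :
    dVar (zeroForm f) = oneForm fun i => mult (flip2 (varDer i f)) := by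
  rw [zeroForm, dVar_mkQ, d_incl_eq_sum, map_sum, oneForm_eq_sum]
  refine Finset.sum_congr rfl fun i _ => ?_
  rw [map_finsum _ (hasFiniteSupport_pd i f (fun n => sandwich (i, n)) (by simp)), varDer,
    map_finsum flip2 (hasFiniteSupport_pd i f (fun n => Spow2 (-n)) (by simp)),
    map_finsum mult (hasFiniteSupport_pd i f (fun n c => flip2 (Spow2 (-n) c)) (by simp)),
    map_finsum (oneFormSingle i)
      (hasFiniteSupport_pd i f (fun n c => mult (flip2 (Spow2 (-n) c))) (by simp))]
  exact finsum_congr fun n => mkQ_sandwich i n _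

/-- The array `∑_n ∂F_j/∂u_{i,n} λ^n`. -/
def jacobian (F : Fin ℓ → DiffPoly k ℓ) : Array2 k ℓ := fun i j =>
  ∑ᶠ n : ℤ, AddMonoidAlgebra.single n (pd (i, n) (F j))

/-- The contribution of the entry `A_{ij}(λ)` to `twoFormRep A`. -/
def twoFormEntry (i j : Fin ℓ) :
    LaurentPolynomial (DiffPoly k ℓ ⊗[k] DiffPoly k ℓ) →ₗ[k] DeRham k ℓ :=
  Finsupp.lsum k (fun n => LinearMap.mulRight k (du (j, 0)) ∘ₗ sandwich (i, n)) ∘ₗ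
    (AddMonoidAlgebra.coeffLinearEquiv k).toLinearMap

theorem twoFormEntry_single (i j : Fin ℓ) (n : ℤ) (c : DiffPoly k ℓ ⊗[k] DiffPoly k ℓ) :
    twoFormEntry i j (AddMonoidAlgebra.single n c) = sandwich (i, n) c * du (j, 0) := by
  change (Finsupp.single n c).sum (fun n c => sandwich (i, n) c * du (j, 0)) = _
  rw [Finsupp.sum_single_index]
  simp

theorem twoForm_eq_sum (A : Array2 k ℓ) :
    twoForm A = ∑ i, ∑ j, (varRel k ℓ).mkQ (twoFormEntry i j (A i j)) := by
  rw [← Finset.sum_congr rfl fun i _ => map_sum (varRel k ℓ).mkQ _ _, ← map_sum]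
  rfl

/-- `adj` as an additive homomorphism. -/
def adjHom : LaurentPolynomial (DiffPoly k ℓ ⊗[k] DiffPoly k ℓ) →+
    LaurentPolynomial (DiffPoly k ℓ ⊗[k] DiffPoly k ℓ) where
  toFun := adj
  map_zero' := by ext n; simp [adj_coeff]
  map_add' A B := by ext n; simp [adj_coeff]

theorem adj_single (n : ℤ) (c : DiffPoly k ℓ ⊗[k] DiffPoly k ℓ) :
    adj (AddMonoidAlgebra.single n c) = AddMonoidAlgebra.single (-n) (Spow2 (-n) (flip2 c)) := by
  rw [adj, AddMonoidAlgebra.coeff_single, Finsupp.sum_single_index]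
  simp

theorem curlArray_eq (F : Fin ℓ → DiffPoly k ℓ) (i j : Fin ℓ) :
    curlArray F i j = (2⁻¹ : k) • (jacobian F i j - adj (jacobian F j i)) := by
  have h : adj (jacobian F j i) =
      ∑ᶠ n : ℤ, AddMonoidAlgebra.single (-n) (Spow2 (-n) (flip2 (pd (j, n) (F i)))) :=
    (AddMonoidHom.map_finsum adjHom (hasFiniteSupport_pd j (F i)
      (fun n => AddMonoidAlgebra.single n) (by simp))).trans
        (finsum_congr fun n => adj_single n _)
  rw [curlArray, h, jacobian, finsum_sub_distrib
    (hasFiniteSupport_pd i (F j) (fun n => AddMonoidAlgebra.single n) (by simp))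
    (hasFiniteSupport_pd j (F i)
      (fun n c => AddMonoidAlgebra.single (-n) (Spow2 (-n) (flip2 c))) (by simp))]

/-- Since δ(δu) = 0, only the coefficients F_j are differentiated. The resulting array need not be
skewadjoint. -/
theorem dVar_oneForm (F : Fin ℓ → DiffPoly k ℓ) : dVar (oneForm F) = twoForm (jacobian F) := by
  rw [oneForm, dVar_mkQ, map_sum, twoForm_eq_sum, Finset.sum_comm, map_sum]
  refine Finset.sum_congr rfl fun j _ => ?_
  rw [d_mul, d_du, mul_zero, zero_add, d_incl_eq_sum, Finset.sum_mul, map_sum]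
  refine Finset.sum_congr rfl fun i _ => ?_
  rw [finsum_mul' _ _ (hasFiniteSupport_pd i (F j) (fun n => sandwich (i, n)) (by simp)), jacobian,
    map_finsum (twoFormEntry i j)
      (hasFiniteSupport_pd i (F j) (fun n => AddMonoidAlgebra.single n) (by simp))]
  simp only [twoFormEntry_single]

/-- The rotation that puts the other δu last exchanges two odd blocks, whence the sign; the shift by
−n restores index 0 on the new last letter. -/
theorem mkQ_twoFormEntry_adj (i j : Fin ℓ)
    (A : LaurentPolynomial (DiffPoly k ℓ ⊗[k] DiffPoly k ℓ)) :
    (varRel k ℓ).mkQ (twoFormEntry i j (adj A)) = -(varRel k ℓ).mkQ (twoFormEntry j i A) := by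
  have hd : ∀ (c : List (Fin ℓ × ℤ)) (x : Fin ℓ × ℤ),
      deg (c.map Sum.inl ++ [Sum.inr x] : List (Letter ℓ)) = 1 := by
    intro c x
    rw [deg_append, deg_map_inl]
    simp [deg]
  induction A using AddMonoidAlgebra.induction_linear with
  | zero =>
    rw [show adj (0 : LaurentPolynomial (DiffPoly k ℓ ⊗[k] DiffPoly k ℓ)) = 0 from map_zero adjHom]
    simp
  | add x y hx hy =>
    rw [show adj (x + y) = adj x + adj y from map_add adjHom x y]
    simp only [map_add, hx, hy, neg_add]
  | single n c =>
    rw [adj_single, twoFormEntry_single, twoFormEntry_single]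
    refine DFunLike.congr_fun
      (f := (varRel k ℓ).mkQ ∘ₗ LinearMap.mulRight k (du (j, 0)) ∘ₗ sandwich (i, -n) ∘ₗ
        Spow2 (-n) ∘ₗ flip2)
      (g := -((varRel k ℓ).mkQ ∘ₗ LinearMap.mulRight k (du (i, 0)) ∘ₗ sandwich (j, n))) ?_ c
    refine tensor_word_hom_ext fun a b => ?_
    simp only [LinearMap.comp_apply, LinearMap.neg_apply, LinearMap.mulRight_apply, flip2_tmul,
      Spow2_tmul, shiftHom_word, sandwich_word, word_mul_du]
    have e : (a.map Sum.inl ++ Sum.inr (j, n) :: b.map Sum.inl) ++ [Sum.inr (i, 0)] =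
      (a.map Sum.inl ++ [Sum.inr (j, n)]) ++ (b.map Sum.inl ++ [Sum.inr (i, 0)]) := by simp
    rw [e, mkQ_word_append (a.map Sum.inl ++ [Sum.inr (j, n)]), hd, hd,
      ← mkQ_word_shift (-n) (_ ++ _ ++ (a.map Sum.inl ++ _))]
    simp only [List.map_append, List.map_cons, List.map_nil, map_shiftLetter_map_inl,
      shiftLetter_inr, add_neg_cancel, zero_add, List.append_assoc, List.cons_append,
      List.nil_append, mul_one, pow_one, neg_smul, one_smul, neg_neg]

theorem twoForm_adj (A : Array2 k ℓ) : twoForm (fun i j => adj (A j i)) = -twoForm A := by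
  rw [twoForm_eq_sum, twoForm_eq_sum, Finset.sum_comm, ← Finset.sum_neg_distrib]
  refine Finset.sum_congr rfl fun i _ => ?_
  rw [← Finset.sum_neg_distrib]
  exact Finset.sum_congr rfl fun j _ => mkQ_twoFormEntry_adj _ _ _

theorem twoFormRep_mem_homog (A : Array2 k ℓ) : twoFormRep A ∈ homog k ℓ (1 + 1) :=
  Submodule.sum_mem _ fun i _ => Submodule.sum_mem _ fun j _ => Submodule.sum_mem _ fun n _ =>
    mul_homog (sandwich_mem_homog (i, n) ((A i j).coeff n)) (du_mem_homog (j, 0))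

/-! ### Closed forms -/

theorem contr_incl (f : DiffPoly k ℓ) : contr (incl f) = 0 := by
  induction f using FreeAlgebra.induction with
  | grade0 r => rw [AlgHom.commutes, contr_algebraMap]
  | grade1 q => simp [incl, uΩ, contr_ι_inl]
  | mul a b ha hb => rw [map_mul, contr_mul, ha, hb]; simp
  | add a b ha hb => rw [map_add, map_add, ha, hb, add_zero]

/-- The projection of the de Rham algebra to its part of degree zero. -/
def degZero : DeRham k ℓ →ₐ[k] DiffPoly k ℓ := FreeAlgebra.lift k (Sum.elim u 0)

theorem degZero_incl (f : DiffPoly k ℓ) : degZero (incl f) = f :=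
  DFunLike.congr_fun (f := (degZero.comp incl : DiffPoly k ℓ →ₐ[k] _)) (g := AlgHom.id k _)
    (by ext p; simp [degZero, incl, uΩ, u]) f

theorem degZero_SΩ (a : DeRham k ℓ) : degZero (SΩ a) = S (degZero a) :=
  DFunLike.congr_fun (f := (degZero.comp SΩ : DeRham k ℓ →ₐ[k] _))
    (g := (S : DiffPoly k ℓ ≃ₐ[k] _).toAlgHom.comp degZero)
    (by ext p; rcases p with p | p <;> simp [degZero, SΩ, uΩ, du, S, shiftHom, u]) a

theorem degZero_word {w : List (Letter ℓ)} (h : deg w ≠ 0) : degZero (word k w) = 0 := by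
  induction w with
  | nil => simp [deg] at h
  | cons x w ih =>
    rw [word_cons, map_mul]
    rcases x with x | x
    · rw [ih (by simpa [deg] using h), mul_zero]
    · simp [degZero]

/-- The projection `degZero` is multiplicative and commutes with S, so it turns supercommutators of
words into ordinary commutators, or into 0 when a δu occurs. -/
theorem mem_trivialFunctions_of_incl_mem {f : DiffPoly k ℓ} (h : incl f ∈ varRel k ℓ) :
    f ∈ trivialFunctions k ℓ := by
  have key : varRel k ℓ ≤ (trivialFunctions k ℓ).comap degZero.toLinearMap := by
    refine varRel_le_of_words _ _ (fun w => ?_) fun v w => ?_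
    · rw [← SΩ_word, AlgHom.toLinearMap_apply, AlgHom.toLinearMap_apply, degZero_SΩ]
      exact Submodule.mem_sup_right ⟨degZero (word k w), by simp⟩
    · rw [AlgHom.toLinearMap_apply, AlgHom.toLinearMap_apply, word_append, word_append, map_mul,
        map_mul]
      by_cases hv : deg v = 0
      · rw [hv, zero_mul, pow_zero, one_smul]
        exact Submodule.mem_sup_left (Submodule.mem_sup_right (Submodule.subset_span ⟨_, _, rfl⟩))
      · rw [degZero_word hv]; simp
  have := key h
  rwa [Submodule.mem_comap, AlgHom.toLinearMap_apply, degZero_incl] at this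

theorem incl_S (f : DiffPoly k ℓ) : incl (S f) = SΩ (incl f) :=
  DFunLike.congr_fun (f := incl.comp (S : DiffPoly k ℓ ≃ₐ[k] _).toAlgHom)
    (g := (SΩ.comp incl : DiffPoly k ℓ →ₐ[k] _))
    (by ext p; simp [incl, SΩ, uΩ, S, shiftHom, u]) f

theorem d_incl_mem_of_mem_trivialFunctions {f : DiffPoly k ℓ} (h : f ∈ trivialFunctions k ℓ) :
    d (incl f) ∈ varRel k ℓ := by
  suffices h' : trivialFunctions k ℓ ≤ (varRel k ℓ).comap (d ∘ₗ incl.toLinearMap) from h' h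
  refine sup_le (sup_le ?_ (Submodule.span_le.2 ?_)) ?_
  · rintro _ ⟨r, rfl⟩
    simp [d_algebraMap]
  · rintro _ ⟨a, b, rfl⟩
    refine varRel_le_comap (Submodule.mem_sup_right (Submodule.subset_span
      ⟨0, 0, _, _, incl_mem_homog a, incl_mem_homog b, ?_⟩))
    simp
  · rintro _ ⟨a, rfl⟩
    refine varRel_le_comap ?_
    simpa [incl_S] using SΩ_sub_mem_varRel (incl a)

variable [CharZero k]

theorem zeroForm_closed_iff (f : DiffPoly k ℓ) :
    dVar (zeroForm f) = 0 ↔ f ∈ trivialFunctions k ℓ := by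
  rw [zeroForm, dVar_mkQ_eq_zero]
  refine ⟨fun h => ?_, d_incl_mem_of_mem_trivialFunctions⟩
  have h1 := sub_d_contr_mem_varRel h
  -- `lenInv` keeps f in degree 0, where contraction vanishes; the homotopy formula then says that f
  -- is congruent to its constant term.
  obtain ⟨g, hg⟩ := exists_incl_of_mem_homog (lenInv_homog (incl_mem_homog f))
  rw [← hg, contr_incl, map_zero, sub_zero] at h1
  set c := FreeAlgebra.algebraMapInv (incl f) with hc
  have h2 : constPart (incl f) = incl (algebraMap k (DiffPoly k ℓ) c) := by
    rw [AlgHom.commutes]; rfl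
  rw [h2, ← map_sub] at h1
  have h3 : algebraMap k (DiffPoly k ℓ) c ∈ trivialFunctions k ℓ :=
    Submodule.mem_sup_left (Submodule.mem_sup_left ⟨c, rfl⟩)
  simpa using Submodule.add_mem _ (mem_trivialFunctions_of_incl_mem h1) h3

/-- A closed form of positive degree is exact. -/
theorem exists_primitive {p : ℕ} {a : DeRham k ℓ} (ha : a ∈ homog k ℓ (p + 1))
    (h : d a ∈ varRel k ℓ) :
    ∃ b ∈ homog k ℓ p, dVar ((varRel k ℓ).mkQ b) = (varRel k ℓ).mkQ a := by
  refine ⟨contr (lenInv a), by simpa using contr_homog (lenInv_homog ha), ?_⟩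
  have h1 := sub_d_contr_mem_varRel h
  rw [constPart_homog_succ ha, sub_zero] at h1
  exact ((Submodule.Quotient.eq _).2 h1).symm

theorem oneForm_closed_iff (F : Fin ℓ → DiffPoly k ℓ) :
    dVar (oneForm F) = 0 ↔ ∃ f : DiffPoly k ℓ, ∀ i, F i = mult (flip2 (varDer i f)) := by
  constructor
  · intro h
    obtain ⟨b, hb, hF⟩ := exists_primitive (p := 0) (Submodule.sum_mem _ fun i _ =>
      mul_homog (incl_mem_homog (F i)) (du_mem_homog (i, 0))) (dVar_mkQ_eq_zero.1 h)
    obtain ⟨f, rfl⟩ := exists_incl_of_mem_homog hb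
    exact ⟨f, congrFun (oneForm_injective (hF.symm.trans (dVar_zeroForm f)))⟩
  · rintro ⟨f, hf⟩
    rw [funext hf, ← dVar_zeroForm, dVar_dVar]

/-- The Jacobian and minus its adjoint transpose represent the same form; the curl array is their
average. -/
theorem twoForm_curlArray (F : Fin ℓ → DiffPoly k ℓ) :
    twoForm (curlArray F) = twoForm (jacobian F) := by
  have h : twoForm (curlArray F) = (2⁻¹ : k) •
      (twoForm (jacobian F) - twoForm fun i j => adj (jacobian F j i)) := by
    simp only [twoForm_eq_sum, curlArray_eq, map_smul, map_sub, Finset.smul_sum,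
      Finset.sum_sub_distrib, smul_sub]
  rw [h, twoForm_adj, sub_neg_eq_add, ← two_smul k, smul_smul, inv_mul_cancel₀ two_ne_zero, one_smul]

theorem twoForm_closed_iff (A : Array2 k ℓ) (hA : IsSkewadjoint A) :
    dVar (twoForm A) = 0 ↔ ∃ F : Fin ℓ → DiffPoly k ℓ, ∀ i j, A i j = curlArray F i j := by
  constructor
  · intro h
    obtain ⟨b, hb, hb'⟩ := exists_primitive (twoFormRep_mem_homog A) (dVar_mkQ_eq_zero.1 h)
    obtain ⟨F, hF⟩ := exists_oneForm_of_mem_homog hb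
    rw [← hF, dVar_oneForm] at hb'
    refine ⟨F, fun i j => ?_⟩
    -- Equality of classes replaces the Jacobian by A in the skewadjoint combination, and
    -- skewadjointness turns that into 2A.
    rw [curlArray_eq, sub_adj_eq_of_twoForm_eq hb', sub_eq_add_neg, ← hA, ← two_smul k, smul_smul,
      inv_mul_cancel₀ two_ne_zero, one_smul]
  · rintro ⟨F, hF⟩
    rw [show A = curlArray F from funext fun i => funext (hF i), twoForm_curlArray, ← dVar_oneForm,
      dVar_dVar]

end NCDiff

end

theorem corollary6p6 {k : Type*} [Field k] [CharZero k] (ℓ : ℕ) :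
    (∀ f : NCDiff.DiffPoly k ℓ,
      NCDiff.dVar (NCDiff.zeroForm f) = 0 ↔ f ∈ NCDiff.trivialFunctions k ℓ) ∧
    (∀ F : Fin ℓ → NCDiff.DiffPoly k ℓ,
      NCDiff.dVar (NCDiff.oneForm F) = 0 ↔
        ∃ f : NCDiff.DiffPoly k ℓ, ∀ i,
          F i = NCDiff.mult (NCDiff.flip2 (NCDiff.varDer i f))) ∧
    (∀ A : NCDiff.Array2 k ℓ, NCDiff.IsSkewadjoint A →
      (NCDiff.dVar (NCDiff.twoForm A) = 0 ↔
        ∃ F : Fin ℓ → NCDiff.DiffPoly k ℓ, ∀ i j,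
          A i j = NCDiff.curlArray F i j)) :=
  ⟨NCDiff.zeroForm_closed_iff, NCDiff.oneForm_closed_iff, NCDiff.twoForm_closed_iff⟩
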